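/- Let $N\ge 1$ and let $G=D_{4N}=\langle r,s\mid r^{4N}=s^2=1,\ srs=r^{-1}\rangle$ be the dihedral group of order $8N$, with the subgroups $K_1=\langle rs\rangle\cong\mathbb Z_2$, $K_2=\langle s\rangle\cong\mathbb Z_2$, $K_3=\langle r\rangle\cong\mathbb Z_{4N}$. For $\kappa:G\to U(1)$ put $(\delta\kappa)(g,h)=\kappa(g)\kappa(h)/\kappa(gh)$. **The cocycle.** For $0\le a,b<4N$ and $j,k\in\{0,1\}$ let $\alpha_N'(r^as^j,r^bs^k)=-1$ if $(a+(1-2j)b)\bmod 8N\ge 4N$, and $=+1$ otherwise. Let $\kappa_N(r^{2N})=-i$, $\kappa_N(r^a)=-1$ for $2N<a<4N$, $\kappa_N=1$ elsewhere, and $\alpha_N=\alpha_N'\,\delta\kappa_N$. Then $H^2(D_{4N},U(1))\cong\mathbb Z_2$, and $\alpha_N$ is a 2-cocycle representing the non-trivial class. It comes from the central extension $D_{8N}\to D_{4N}$, $r\mapsto r$, $s\mapsto s$, with kernel $\langle r^{4N}\rangle\cong\mathbb Z_2$: for the lift $\ell(r^as^j)=r^as^j$ ($0\le a<4N$) and the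 character $\lambda$ of the kernel with $\lambda(r^{4N})=-1$, one has $\alpha_N'(g,h)=\lambda(\ell(g)\ell(h)\ell(gh)^{-1})$. **Trivialization on the boundaries.** $\alpha_N$ is identically $1$ on $K_1$ and on $K_2$, and $\alpha_N|_{K_3}=\delta\beta_N$, where $\beta_N(r^a)=e^{i\pi a/(4N)}$ for $0\le a<2N$, $\beta_N(r^{2N})=1$, $\beta_N(r^a)=-e^{i\pi a/(4N)}$ for $2N<a<4N$. Moreover $\alpha_N(rs,s)=1$. Put $\beta^{(1)}=\beta^{(2)}=1$ and $\beta^{(3)}(r^as^j)=\beta_N(r^a)$; then $\beta^{(i)}=\beta^{(j)}$ on $K_i\cap K_j$ for all $i,j$. With $$U_{\alpha,\beta}(g_1,g_2)=\frac{\alpha_N(g_1,g_2)\,\beta^{(3)}(g_1g_2)}{\beta^{(1)}(g_1)\,\beta^{(2)}(g_2)}$$ one has $U_{\alpha,\beta}(1,1)=1$, $(rs)s=r$ and $U_{\alpha,\beta}(rs,s)=e^{i\pi/(4N)}$. **The code and the gate.** Consider Kitaev's quantum double model of $G$ on a square lattice patch of $m\times n$ plaquettes ($m,n\ge1$), with a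 copy of $\mathbb C[G]$ on each edge, horizontal edges oriented to the right and vertical edges upwards. The left side carries the gapped boundary $K_1$, the top side $K_2$, the bottom and right sides together $K_3$. Let $A_v$ be the average of the vertex operators $A_v^g$ over all $g\in G$ if $v$ is in the bulk, over $g\in K_i$ if $v$ lies on side $i$, and over $g\in K_i\cap K_j$ at a corner of two sides $i\ne j$. The code space consists of the states fixed by all $A_v$, by all projectors $B_p$ on trivial flux through a plaquette, and by the projectors on labels in $K_i$ at the edges of side $i$. For $g_1\in K_1$, $g_2\in K_2$ with $g_1g_2\in K_3$ let $\overline{|g_1,g_2\rangle}=\prod_vA_v\,L_{\xi_1}^{g_1}L_{\xi_2}^{g_2}L_{\xi_3}^{g_1g_2}\bigotimes_e|1\rangle_e$, where $\xi_1,\xi_2,\xi_3$ are the straight dual ribbons from the left, top and bottom side to one plaquette $p$, and $L^g_\xi$ multiplies the labels on $\xi$ from the left by $g$. Let $U_{\alpha,\beta}$ be the product of - over all plaquettes with left, top, right, bottom labels $g_1,g_2,g_3,g_4$, the diagonal gates with phase $\alpha_N(g_1,g_2)/\alpha_N(g_4,g_3)$, and - over the boundary edges with label $g$, the diagonal gates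 with phase $\beta^{(1)}(g)^{-1}$, $\beta^{(2)}(g)^{-1}$, $\beta^{(3)}(g)$ on the sides $1,2,3$ respectively. Then for all $m,n\ge1$ and every plaquette $p$: 1. $\overline{|0\rangle}:=\overline{|1,1\rangle}$ and $\overline{|1\rangle}:=\overline{|rs,s\rangle}$ are non-zero, orthogonal, of equal norm, and span the code space, which is thus a single logical qubit. 2. They are the eigenvectors, with eigenvalues $+1$ and $-1$, of the logical $\overline Z$, the electric triangle formed by the characters $1_{rs}$, $1_s$, $1_r$ along straight paths from the left, top and right sides to any vertex; here $1_r(r)=1$, $1_r(s)=-1$, $1_s(r)=-1$, $1_s(s)=1$, $1_{rs}=1_r1_s$. 3. $U_{\alpha,\beta}$ is unitary and is a circuit of at most $5$ layers of unitary gates with disjoint supports within a layer, each gate acting on edges of a single plaquette. 4. $U_{\alpha,\beta}$ preserves the code space and acts on the logical qubit as $$T^{1/N}=P\!\left(\tfrac{\pi}{4N}\right)=\operatorname{diag}\left(1,e^{i\pi/(4N)}\right)$$ in the basis $\overline{|0\rangle},\overline{|1\rangle}$. -/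

import Mathlib

open scoped Matrix

noncomputable section

set_option linter.unusedSectionVars false

namespace QuantumDouble

/-! ### The square patch with three gapped boundaries

The patch has `m` columns and `n` rows of plaquettes.  Vertices are the points `(x, y)` with
`0 ≤ x ≤ m`, `0 ≤ y ≤ n`; horizontal edges point to the right, vertical edges upwards. -/

/-- Vertices of the patch. -/
abbrev Vertex (m n : ℕ) := Fin (m + 1) × Fin (n + 1)

/-- Edges: `inl (x, y)` is the horizontal edge from `(x, y)` to `(x + 1, y)`, and `inr (x, y)` is
the vertical edge from `(x, y)` to `(x, y + 1)`. -/
abbrev Edge (m n : ℕ) := (Fin m × Fin (n + 1)) ⊕ (Fin (m + 1) × Fin n)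

/-- Plaquettes, labelled by their lower left corner. -/
abbrev Plaquette (m n : ℕ) := Fin m × Fin n

variable {m n : ℕ}

/-- Initial vertex of an edge. -/
def src : Edge m n → Vertex m n
  | .inl (x, y) => (x.castSucc, y)
  | .inr (x, y) => (x, y.castSucc)

/-- Final vertex of an edge. -/
def tgt : Edge m n → Vertex m n
  | .inl (x, y) => (x.succ, y)
  | .inr (x, y) => (x, y.succ)

/-- The four edges of a plaquette. -/
def leftEdge (p : Plaquette m n) : Edge m n := .inr (p.1.castSucc, p.2)
def topEdge (p : Plaquette m n) : Edge m n := .inl (p.1, p.2.succ)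
def rightEdge (p : Plaquette m n) : Edge m n := .inr (p.1.succ, p.2)
def bottomEdge (p : Plaquette m n) : Edge m n := .inl (p.1, p.2.castSucc)

def plaquetteEdges (p : Plaquette m n) : Finset (Edge m n) :=
  {leftEdge p, topEdge p, rightEdge p, bottomEdge p}

/-- The three sides of the "triangle": the first is the left side of the patch, the second is the
top side, the third consists of the bottom side and the right side. -/
def boundaryEdges (m n : ℕ) : Fin 3 → Finset (Edge m n) :=
  ![Finset.univ.filter fun e => ∃ y, e = .inr (0, y),
    Finset.univ.filter fun e => ∃ x, e = .inl (x, Fin.last n),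
    Finset.univ.filter fun e => (∃ x, e = .inl (x, 0)) ∨ ∃ y, e = .inr (Fin.last m, y)]

/-- The vertex `v` lies on the `i`-th side. -/
def OnBoundary (i : Fin 3) (v : Vertex m n) : Prop :=
  ∃ e ∈ boundaryEdges m n i, src e = v ∨ tgt e = v

/-! ### States and operators

Each edge carries `ℂ[G]`, so the total Hilbert space is the space of functions on the finite set
of labellings of the edges by group elements, with its standard inner product. -/

/-- Labellings of the edges: the product basis of the Hilbert space. -/
abbrev Config (G : Type) (m n : ℕ) := Edge m n → G

/-- State vectors. -/
abbrev State (G : Type) (m n : ℕ) := Config G m n → ℂ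

/-- Operators, as matrices in the product basis. -/
abbrev Op (G : Type) (m n : ℕ) := Matrix (Config G m n) (Config G m n) ℂ

variable {G : Type} [Group G] [Fintype G] [DecidableEq G]

/-- The basis vector `|c⟩`. -/
def ket (c : Config G m n) : State G m n := Pi.single c 1

/-- The operator `|c⟩ ↦ |f c⟩`. -/
def mapOp (f : Config G m n → Config G m n) : Op G m n :=
  Matrix.of fun c' c => if c' = f c then 1 else 0

/-- The gauge transformation by `γ`: the edge `e` from `v` to `w` with label `h` gets the label
`γ v * h * (γ w)⁻¹`. -/
def gauge (γ : Vertex m n → G) (c : Config G m n) : Config G m n :=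
  fun e => γ (src e) * c e * (γ (tgt e))⁻¹

/-- The vertex operator `A_v^g`: left multiplication by `g` on the edges leaving `v`, and right
multiplication by `g⁻¹` on the edges entering `v` (on the boundary: on those that exist). -/
def vertexOp (v : Vertex m n) (g : G) : Op G m n := mapOp (gauge (Pi.mulSingle v g))

/-- The group elements by which one may act at `v`: all of `G` at a vertex in the bulk, `K i` at a
vertex on side `i`, and `K i ⊓ K j` at a corner of the sides `i` and `j`. -/
def vertexGroup (K : Fin 3 → Subgroup G) (v : Vertex m n) : Subgroup G :=
  ⨅ i : Fin 3, ⨅ _ : OnBoundary i v, K i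

open Classical in
/-- The projector `A_v` (in the bulk) or `A_v^K` (on the boundary): the average of the operators
`A_v^g` over the admissible `g`. -/
def vertexProj (K : Fin 3 → Subgroup G) (v : Vertex m n) : Op G m n :=
  ((Finset.univ.filter fun g : G => g ∈ vertexGroup K v).card : ℂ)⁻¹ •
    ∑ g ∈ Finset.univ.filter (fun g : G => g ∈ vertexGroup K v), vertexOp v g

/-- The plaquette operator `B_p^g`: the projector on flux `g` through `p`. -/
def plaquetteOp (p : Plaquette m n) (g : G) : Op G m n :=
  Matrix.diagonal fun c =>
    if c (leftEdge p) * c (topEdge p) * (c (rightEdge p))⁻¹ * (c (bottomEdge p))⁻¹ = g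
    then 1 else 0

open Classical in
/-- The boundary term `B_e^K`: the projector on labels in `K` at the edge `e`. -/
def boundaryProj (K : Subgroup G) (e : Edge m n) : Op G m n :=
  Matrix.diagonal fun c => if c e ∈ K then 1 else 0

/-- The code space: the states fixed by all the terms of the quantum double Hamiltonian
`-∑ A_v - ∑ B_p - ∑ (boundary terms)` with gapped boundaries given by `K 0`, `K 1`, `K 2`. -/
def codeSpace (m n : ℕ) (K : Fin 3 → Subgroup G) : Submodule ℂ (State G m n) where
  carrier := {ψ | (∀ v, vertexProj K v *ᵥ ψ = ψ) ∧ (∀ p, plaquetteOp p 1 *ᵥ ψ = ψ) ∧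
    ∀ i, ∀ e ∈ boundaryEdges m n i, boundaryProj (K i) e *ᵥ ψ = ψ}
  add_mem' := by
    rintro a b ⟨h1, h2, h3⟩ ⟨k1, k2, k3⟩
    refine ⟨fun v => ?_, fun p => ?_, fun i e he => ?_⟩
    · rw [Matrix.mulVec_add, h1, k1]
    · rw [Matrix.mulVec_add, h2, k2]
    · rw [Matrix.mulVec_add, h3 i e he, k3 i e he]
  zero_mem' := by simp
  smul_mem' := by
    rintro a b ⟨h1, h2, h3⟩
    refine ⟨fun v => ?_, fun p => ?_, fun i e he => ?_⟩
    · rw [Matrix.mulVec_smul, h1]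
    · rw [Matrix.mulVec_smul, h2]
    · rw [Matrix.mulVec_smul, h3 i e he]

/-! ### Logical states -/

theorem mapOp_mul (f g : Config G m n → Config G m n) : mapOp f * mapOp g = mapOp (f ∘ g) := by
  ext c c'
  simp [mapOp, Matrix.mul_apply]

theorem gauge_comp (γ δ : Vertex m n → G) : gauge (m := m) (n := n) γ ∘ gauge δ = gauge (γ * δ) := by
  funext c e
  simp [gauge, mul_assoc]

theorem vertexOp_commute {v w : Vertex m n} (h : v ≠ w) (g g' : G) :
    Commute (vertexOp v g) (vertexOp w g') := by
  have := (Pi.mulSingle_commute (f := fun _ : Vertex m n => G) h g g').eq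
  simp only [Commute, SemiconjBy, vertexOp, mapOp_mul, gauge_comp, this]

theorem vertexProj_commute (K : Fin 3 → Subgroup G) {v w : Vertex m n} (h : v ≠ w) :
    Commute (vertexProj K v) (vertexProj K w) := by
  classical
  unfold vertexProj
  refine Commute.smul_left (Commute.smul_right ?_ _) _
  exact Commute.sum_left _ _ _ fun g _ => Commute.sum_right _ _ _ fun g' _ =>
    vertexOp_commute h g g'

/-- `∏_v A_v`, over all vertices of the patch (bulk and boundary). -/
def vertexProjProd (m n : ℕ) (K : Fin 3 → Subgroup G) : Op G m n :=
  Finset.univ.noncommProd (fun v : Vertex m n => vertexProj K v)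
    fun _ _ _ _ h => vertexProj_commute K h

/-- Left multiplication by `g` on all the edges in `ξ`. -/
def leftMulOp (ξ : Finset (Edge m n)) (g : G) : Op G m n :=
  mapOp fun c e => if e ∈ ξ then g * c e else c e

/-- The three dual ribbons from the sides of the patch to the plaquette `p`: the vertical edges in
the row of `p` to the left of (the centre of) `p`, the horizontal edges in the column of `p` above
it, and the horizontal edges in the column of `p` below it. -/
def ribbon (p : Plaquette m n) : Fin 3 → Finset (Edge m n) :=
  ![Finset.univ.filter fun e => ∃ x, x ≤ p.1.castSucc ∧ e = .inr (x, p.2),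
    Finset.univ.filter fun e => ∃ y, p.2.succ ≤ y ∧ e = .inl (p.1, y),
    Finset.univ.filter fun e => ∃ y, y ≤ p.2.castSucc ∧ e = .inl (p.1, y)]

/-- The state `|g₁, g₂⟩` of the magnetic anyon triangle with labels `g₁`, `g₂`, `g₁ g₂` meeting
in the plaquette `p`:
`∏_v A_v` applied to `L_{ξ₁}^{g₁} L_{ξ₂}^{g₂} L_{ξ₃}^{g₁ g₂} ⨂_e |1⟩`.  It is not normalized. -/
def magneticState (K : Fin 3 → Subgroup G) (p : Plaquette m n) (g₁ g₂ : G) : State G m n :=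
  (vertexProjProd m n K * leftMulOp (ribbon p 0) g₁ * leftMulOp (ribbon p 1) g₂ *
    leftMulOp (ribbon p 2) (g₁ * g₂)) *ᵥ ket 1

/-- The electric anyon triangle for three functions (characters) on `G` meeting at the
vertex `v`: `χ₁` along the horizontal path from the left side to `v`, `χ₂` along the vertical path
from the top side to `v`, `χ₃` along the horizontal path from `v` to the right side. -/
def electricOp (χ₁ χ₂ χ₃ : G → ℂ) (v : Vertex m n) : Op G m n :=
  Matrix.diagonal fun c =>
    (∏ x ∈ Finset.univ.filter (fun x : Fin m => x.castSucc < v.1), χ₁ (c (.inl (x, v.2)))) *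
    (∏ y ∈ Finset.univ.filter (fun y : Fin n => v.2 ≤ y.castSucc), χ₂ (c (.inr (v.1, y)))) *
    (∏ x ∈ Finset.univ.filter (fun x : Fin m => v.1 ≤ x.castSucc), χ₃ (c (.inl (x, v.2))))

/-! ### The transversal gate -/

/-- The gate evaluating the 2-cochain `α` on the two triangles of the plaquette `p`, which have
opposite orientations. -/
def plaquetteGate (α : G → G → Circle) (p : Plaquette m n) : Op G m n :=
  Matrix.diagonal fun c =>
    ((α (c (leftEdge p)) (c (topEdge p)) / α (c (bottomEdge p)) (c (rightEdge p)) : Circle) : ℂ)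

/-- The gate multiplying `|g⟩` by `β g` at the edge `e`. -/
def edgeGate (β : G → Circle) (e : Edge m n) : Op G m n :=
  Matrix.diagonal fun c => (β (c e) : ℂ)

theorem plaquetteGate_commute (α : G → G → Circle) (p q : Plaquette m n) :
    Commute (plaquetteGate α p) (plaquetteGate α q) :=
  Matrix.commute_diagonal _ _

theorem edgeGate_commute (β : G → Circle) (e f : Edge m n) :
    Commute (edgeGate β e) (edgeGate β f) :=
  Matrix.commute_diagonal _ _

/-- `∏_{e ∈ S} M_e^β`. -/
def edgeGateProd (β : G → Circle) (S : Finset (Edge m n)) : Op G m n :=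
  S.noncommProd (fun e => edgeGate β e) fun _ _ _ _ _ => edgeGate_commute β _ _

/-- The unitary `U_{α,β}`: the product of the local gates of `α` over all plaquettes, with the
boundary counterterms `(β 0)⁻¹`, `(β 1)⁻¹` and `β 2` on the three sides. -/
def sptGate (m n : ℕ) (α : G → G → Circle) (β : Fin 3 → G → Circle) : Op G m n :=
  Finset.univ.noncommProd (fun p : Plaquette m n => plaquetteGate α p)
      (fun _ _ _ _ _ => plaquetteGate_commute α _ _) *
    (edgeGateProd (β 0) (boundaryEdges m n 0))ᴴ *
    (edgeGateProd (β 1) (boundaryEdges m n 1))ᴴ *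
    edgeGateProd (β 2) (boundaryEdges m n 2)

/-- The phase `α(g₁, g₂) β₃(g₁ g₂) / (β₁(g₁) β₂(g₂))`. -/
def sptPhase (α : G → G → Circle) (β : Fin 3 → G → Circle) (g₁ g₂ : G) : Circle :=
  α g₁ g₂ * β 2 (g₁ * g₂) / (β 0 g₁ * β 1 g₂)

open Classical in
/-- The operator `O` acts only on the edges in `S`: it is of the form `o ⊗ 1`. -/
def ActsOn (S : Finset (Edge m n)) (O : Op G m n) : Prop :=
  ∃ o : (S → G) → (S → G) → ℂ, ∀ c' c : Config G m n,
    O c' c = if ∀ e ∉ S, c' e = c e then o (fun e => c' e) (fun e => c e) else 0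

/-- A layer of a geometrically local circuit: unitary gates with pairwise disjoint supports, each
supported on the edges of one plaquette. -/
def IsLocalLayer (l : List (Finset (Edge m n) × Op G m n)) : Prop :=
  l.Pairwise (fun a b => Disjoint a.1 b.1) ∧
    ∀ a ∈ l, (∃ p, a.1 ⊆ plaquetteEdges p) ∧ ActsOn a.1 a.2 ∧
      a.2 ∈ Matrix.unitaryGroup (Config G m n) ℂ

/-- `U` is a geometrically local circuit of depth at most `D`. -/
def IsLocalCircuit (D : ℕ) (U : Op G m n) : Prop :=
  ∃ layers : List (List (Finset (Edge m n) × Op G m n)), layers.length ≤ D ∧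
    (∀ l ∈ layers, IsLocalLayer l) ∧
    U = (layers.map fun l => (l.map Prod.snd).prod).prod

/-- The single qubit phase gate `P(θ) = diag(1, e^{iθ})`. -/
def phaseGate (θ : ℝ) : Matrix (Fin 2) (Fin 2) ℂ :=
  Matrix.diagonal ![1, Complex.exp (θ * Complex.I)]

/-- The encoding of one qubit by two state vectors. -/
def encode (ψ₀ ψ₁ : State G m n) (w : Fin 2 → ℂ) : State G m n := w 0 • ψ₀ + w 1 • ψ₁

end QuantumDouble

/-! ### Group cohomology with coefficients in `U(1)` -/

/-- `U(1)` with the trivial action of `G`, written additively. -/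
abbrev u1Rep (G : Type) [Group G] : Rep ℤ G := Rep.trivial ℤ G (Additive Circle)

/-- `H²(G, U(1))`. -/
abbrev H2U1 (G : Type) [Group G] := groupCohomology.H2 (u1Rep G)

/-- A function of two variables with values in `U(1)` as an inhomogeneous 2-cochain. -/
def toCochain {G : Type} [Group G] (α : G → G → Circle) : G × G → u1Rep G :=
  fun x => Additive.ofMul (α x.1 x.2)

/-- The coboundary `(δκ)(g, h) = κ(g) κ(h) / κ(gh)`. -/
def coboundary {G : Type} [Group G] (κ : G → Circle) (g h : G) : Circle :=
  κ g * κ h / κ (g * h)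

/-! ### The dihedral group of order `8N`

`DihedralGroup k` has order `2k`, and its element `sr i` is `s r^i = r^{-i} s`. -/

namespace Dihedral4N

/-- The dihedral group `D_{4N}` of order `8N`. -/
abbrev D (N : ℕ) := DihedralGroup (4 * N)

/-- The rotation `r` and the reflection `s`. -/
def r (N : ℕ) : D N := .r 1
def s (N : ℕ) : D N := .sr 0

/-- The exponent `a ∈ {0, …, 4N - 1}` of an element `r^a s^j`. -/
def rotExp {N : ℕ} : D N → ℕ
  | .r i => i.val
  | .sr i => (-i).val

/-- The exponent `j ∈ {0, 1}` of an element `r^a s^j`. -/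
def reflExp {N : ℕ} : D N → ℕ
  | .r _ => 0
  | .sr _ => 1

/-- The characters `1_r`, `1_s` and `1_{rs}`: the first is `1` at `r` and `-1` at `s`, the second
is `-1` at `r` and `1` at `s`, the third is their product. -/
def chiR {N : ℕ} (g : D N) : ℂ := (-1) ^ reflExp g
def chiS {N : ℕ} (g : D N) : ℂ := (-1) ^ rotExp g
def chiRS {N : ℕ} (g : D N) : ℂ := chiR g * chiS g

/-- The projection `D_{8N} → D_{4N}`, `r ↦ r`, `s ↦ s`, of the dihedral group of order `16N`. -/
def proj (N : ℕ) : DihedralGroup (8 * N) →* D N where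
  toFun
    | .r i => .r (ZMod.castHom (Dvd.intro_left 2 (by ring)) (ZMod (4 * N)) i)
    | .sr i => .sr (ZMod.castHom (Dvd.intro_left 2 (by ring)) (ZMod (4 * N)) i)
  map_one' := by
    change DihedralGroup.r _ = DihedralGroup.r 0
    rw [map_zero]
  map_mul' := by
    rintro (i | i) (j | j) <;> simp [map_add, map_sub]

/-- The lift of `r^a s^j` with `0 ≤ a < 4N` to the element `r^a s^j` of `D_{8N}`. -/
def lift (N : ℕ) (g : D N) : DihedralGroup (8 * N) :=
  .r 1 ^ rotExp g * .sr 0 ^ reflExp g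

/-- The cocycle of the extension `D_{8N} → D_{4N}` for the above lift. -/
def alpha' (N : ℕ) (g h : D N) : Circle :=
  if (4 * N : ℤ) ≤ ((rotExp g : ℤ) + (1 - 2 * reflExp g) * rotExp h) % (8 * N) then -1 else 1

/-- The 1-cochain `κ_N`. -/
def kappa (N : ℕ) (g : D N) : Circle :=
  if reflExp g = 0 ∧ rotExp g = 2 * N then Circle.exp (-(Real.pi / 2))
  else if reflExp g = 0 ∧ 2 * N < rotExp g then -1
  else 1

/-- The cocycle `α_N = α'_N · δκ_N`. -/
def alpha (N : ℕ) (g h : D N) : Circle := alpha' N g h * coboundary (kappa N) g h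

/-- The 1-cochain `β_N` (extended from `⟨r⟩` to the whole group by ignoring `s`). -/
def beta (N : ℕ) (g : D N) : Circle :=
  if rotExp g < 2 * N then Circle.exp (Real.pi * rotExp g / (4 * N))
  else if rotExp g = 2 * N then 1
  else -Circle.exp (Real.pi * rotExp g / (4 * N))

/-- The boundary subgroups `⟨rs⟩`, `⟨s⟩`, `⟨r⟩`. -/
def bdry (N : ℕ) : Fin 3 → Subgroup (D N) :=
  ![Subgroup.zpowers (r N * s N), Subgroup.zpowers (s N), Subgroup.zpowers (r N)]

/-- The boundary 1-cochains: trivial on the first two sides, `β_N` on the third. -/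
def betas (N : ℕ) : Fin 3 → D N → Circle := ![1, 1, beta N]

end Dihedral4N

end

/-! A flat labelling has a potential `φ` with value `1` at the lower left corner, and the label of
an edge is `(φ src)⁻¹ * φ tgt`. The boundary conditions confine `φ` to `K 0` on the left side, to `K
2` on the bottom and right sides, and to the coset `g₁ K 1` on the top side, where `g₁` is the
holonomy of the left side. Distinct `K i` meet trivially, so an admissible gauge transformation is
`1` at the three corners where two sides meet. It therefore preserves the holonomies `g₁`, `g₂` of
the left and top sides, and the gauge group acts simply transitively on the sector of labellings
with given `(g₁, g₂)` (`exists_gauge_eq`, `gauge_injective`). Code states are the functions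
supported on admissible labellings and constant on sectors (`mem_codeSpace_iff`), and a magnetic
state is the uniform superposition over one sector (`magneticState_apply`). For the dihedral data
only two pairs `(g₁, g₂)` occur (`eq_labels`), whence one qubit.

The electric triangle and the gate are diagonal, so it suffices that they are constant on sectors.
For the former, products of characters along paths telescope. For the latter, `sptFun_eq_sptPhase`
is a discrete Stokes theorem: by the cocycle identity the phase of a plaquette is the lattice curl
of the edge function `α (φ src) (c e)`, so the bulk cancels. On the sides `α` is the coboundary of
`β`, and what remains telescopes against the counterterms to one phase depending on `(g₁, g₂)`.

For the cohomology, a cocycle defines a central extension by `U(1)`, which splits as soon as the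
generators lift to elements satisfying the dihedral relations. As `U(1)` is divisible, rescaling the
lifts achieves this up to a single obstruction, the sign `α(z, s) / α(s, z)` with `z = r^{2N}`
(`DihedralGroup.exists_coboundary`). The sign is multiplicative in `α` and equals `-1` for `alpha
N`, so it identifies `H²` with `ℤ/2`. -/

namespace QuantumDouble

/-! ### Telescoping products along a line of edges -/

section Telescope

variable {M : Type*} [CommMonoid M] {k : ℕ} {F : Fin (k + 1) → M} {g : Fin k → M}

/-- In the applications `F` is a character or cochain evaluated on a potential and `g` its increment
along an edge, so that path products depend only on the endpoints. -/
theorem mul_prod_castSucc_lt (h : ∀ x, F x.castSucc * g x = F x.succ) (v : Fin (k + 1)) :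
    F 0 * ∏ x ∈ Finset.univ.filter (fun x : Fin k => x.castSucc < v), g x = F v := by
  induction v using Fin.induction with
  | zero => simp
  | succ i ih =>
    have : Finset.univ.filter (fun x : Fin k => x.castSucc < i.succ) =
        insert i (Finset.univ.filter fun x : Fin k => x.castSucc < i.castSucc) := by
      ext x
      simp only [Finset.mem_filter, Finset.mem_univ, true_and, Finset.mem_insert, Fin.lt_def,
        Fin.ext_iff, Fin.val_castSucc, Fin.val_succ]
      omega
    rw [this, Finset.prod_insert (by simp), mul_left_comm, ih, mul_comm, h]

theorem mul_prod_le_castSucc (h : ∀ x, F x.castSucc * g x = F x.succ) (v : Fin (k + 1)) :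
    F v * ∏ x ∈ Finset.univ.filter (fun x : Fin k => v ≤ x.castSucc), g x = F (Fin.last k) := by
  induction v using Fin.reverseInduction with
  | last =>
    have : Finset.univ.filter (fun x : Fin k => Fin.last k ≤ x.castSucc) = ∅ := by
      ext x
      have := x.2
      simp [Fin.le_def]
    rw [this, Finset.prod_empty, mul_one]
  | cast i ih =>
    have : Finset.univ.filter (fun x : Fin k => i.castSucc ≤ x.castSucc) =
        insert i (Finset.univ.filter fun x : Fin k => i.succ ≤ x.castSucc) := by
      ext x
      simp only [Finset.mem_filter, Finset.mem_univ, true_and, Finset.mem_insert, Fin.le_def,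
        Fin.ext_iff, Fin.val_castSucc, Fin.val_succ]
      omega
    rw [this, Finset.prod_insert (by simp [Fin.le_def]), ← mul_assoc, h, ih]

theorem mul_prod_univ (h : ∀ x, F x.castSucc * g x = F x.succ) :
    F 0 * ∏ x, g x = F (Fin.last k) := by
  simpa using mul_prod_le_castSucc h 0

end Telescope

variable {m n : ℕ} {G : Type} [Group G]

/-! ### Potentials of flat configurations -/

/-- Trivial flux through every plaquette. -/
def IsFlat (c : Config G m n) : Prop :=
  ∀ p, c (leftEdge p) * c (topEdge p) = c (bottomEdge p) * c (rightEdge p)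

/-- The product of the labels along the path from the lower left corner to `v` that goes first
right and then up. -/
def potential (c : Config G m n) (v : Vertex m n) : G :=
  Fin.partialProd (fun i => c (.inl (i, 0))) v.1 * Fin.partialProd (fun j => c (.inr (v.1, j))) v.2

@[simp] theorem potential_zero (c : Config G m n) : potential c (0, 0) = 1 := by
  simp [potential]

theorem potential_inr (c : Config G m n) (x : Fin (m + 1)) (y : Fin n) :
    potential c (x, y.castSucc) * c (.inr (x, y)) = potential c (x, y.succ) := by
  simp [potential, Fin.partialProd_succ, mul_assoc]

/-- The defining path of `potential` ends vertically, so vertical steps need no flatness. A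
horizontal step holds by definition in the bottom row, and flatness of one plaquette carries it up
to the next row. -/
theorem IsFlat.potential_inl {c : Config G m n} (hc : IsFlat c) (x : Fin m) (y : Fin (n + 1)) :
    potential c (x.castSucc, y) * c (.inl (x, y)) = potential c (x.succ, y) := by
  induction y using Fin.induction with
  | zero => simp [potential, Fin.partialProd_succ]
  | succ j ih =>
    have h := hc (x, j)
    simp only [leftEdge, topEdge, bottomEdge, rightEdge] at h
    rw [← potential_inr, ← potential_inr, mul_assoc, h, ← mul_assoc, ih]

theorem IsFlat.potential_src_mul {c : Config G m n} (hc : IsFlat c) (e : Edge m n) :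
    potential c (src e) * c e = potential c (tgt e) := by
  rcases e with ⟨x, y⟩ | ⟨x, y⟩
  · exact hc.potential_inl x y
  · exact potential_inr c x y

theorem isFlat_of_potential {c : Config G m n} {φ : Vertex m n → G}
    (h : ∀ e, φ (src e) * c e = φ (tgt e)) : IsFlat c := by
  intro p
  have h1 := h (leftEdge p)
  have h2 := h (topEdge p)
  have h3 := h (bottomEdge p)
  have h4 := h (rightEdge p)
  simp only [leftEdge, topEdge, bottomEdge, rightEdge, src, tgt] at h1 h2 h3 h4 ⊢
  rw [← h1, mul_assoc] at h2
  rw [← h3, mul_assoc, ← h2] at h4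
  exact (mul_left_cancel h4).symm

/-- Potentials of a labelling are unique up to a constant on the left, because the patch is
connected. A potential with value `1` at the origin is thus `potential c`, which identifies the
potentials of gauge transforms and of ribbon configurations. -/
theorem eq_mul_potential {c : Config G m n} {φ : Vertex m n → G}
    (h : ∀ e, φ (src e) * c e = φ (tgt e)) (v : Vertex m n) :
    φ v = φ (0, 0) * potential c v := by
  obtain ⟨x, y⟩ := v
  induction y using Fin.induction with
  | zero =>
    induction x using Fin.induction with
    | zero => simp
    | succ i ih =>
      rw [← (isFlat_of_potential h).potential_inl, ← mul_assoc, ← ih]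
      exact (h (.inl (i, 0))).symm
  | succ j ih =>
    rw [← potential_inr, ← mul_assoc, ← ih]
    exact (h (.inr (x, j))).symm

/-! ### Gauge transformations -/

theorem gauge_potential {c : Config G m n} {φ : Vertex m n → G}
    (h : ∀ e, φ (src e) * c e = φ (tgt e)) (γ : Vertex m n → G) (e : Edge m n) :
    (φ (src e) * (γ (src e))⁻¹) * gauge γ c e = φ (tgt e) * (γ (tgt e))⁻¹ := by
  rw [← h]
  simp [gauge, mul_assoc]

theorem IsFlat.gauge {c : Config G m n} (hc : IsFlat c) (γ : Vertex m n → G) :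
    IsFlat (gauge γ c) :=
  isFlat_of_potential (φ := fun v => potential c v * (γ v)⁻¹)
    (gauge_potential hc.potential_src_mul γ)

theorem IsFlat.potential_gauge {c : Config G m n} (hc : IsFlat c) (γ : Vertex m n → G)
    (v : Vertex m n) :
    potential (QuantumDouble.gauge γ c) v = γ (0, 0) * potential c v * (γ v)⁻¹ := by
  have := eq_mul_potential (φ := fun v => potential c v * (γ v)⁻¹)
    (gauge_potential hc.potential_src_mul γ) v
  simp only [potential_zero, one_mul] at this
  rw [mul_assoc, this, mul_inv_cancel_left]

theorem gauge_one (c : Config G m n) : gauge (1 : Vertex m n → G) c = c := by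
  funext e
  simp [gauge]

theorem gauge_mul (γ δ : Vertex m n → G) (c : Config G m n) :
    gauge (γ * δ) c = gauge γ (gauge δ c) := by
  funext e
  simp [gauge, mul_assoc]

theorem gauge_inv_gauge (γ : Vertex m n → G) (c : Config G m n) : gauge γ⁻¹ (gauge γ c) = c := by
  rw [← gauge_mul, inv_mul_cancel, gauge_one]

theorem gauge_gauge_inv (γ : Vertex m n → G) (c : Config G m n) : gauge γ (gauge γ⁻¹ c) = c := by
  rw [← gauge_mul, mul_inv_cancel, gauge_one]

/-- The gauge transformations that respect the gapped boundaries. -/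
def gaugeGroup (m n : ℕ) (K : Fin 3 → Subgroup G) : Subgroup (Vertex m n → G) :=
  Subgroup.pi Set.univ fun v => vertexGroup K v

theorem mem_vertexGroup {K : Fin 3 → Subgroup G} {v : Vertex m n} {g : G} :
    g ∈ vertexGroup K v ↔ ∀ i, OnBoundary i v → g ∈ K i := by
  simp [vertexGroup, Subgroup.mem_iInf]

theorem mem_gaugeGroup {K : Fin 3 → Subgroup G} {γ : Vertex m n → G} :
    γ ∈ gaugeGroup m n K ↔ ∀ v i, OnBoundary i v → γ v ∈ K i := by
  simp [gaugeGroup, Subgroup.mem_pi, mem_vertexGroup]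

/-- Flat configurations satisfying the boundary conditions. -/
def IsAdmissible (K : Fin 3 → Subgroup G) (c : Config G m n) : Prop :=
  IsFlat c ∧ ∀ i, ∀ e ∈ boundaryEdges m n i, c e ∈ K i

theorem IsAdmissible.gauge {K : Fin 3 → Subgroup G} {c : Config G m n} (hc : IsAdmissible K c)
    {γ : Vertex m n → G} (hγ : γ ∈ gaugeGroup m n K) : IsAdmissible K (gauge γ c) := by
  rw [mem_gaugeGroup] at hγ
  refine ⟨hc.1.gauge γ, fun i e he => ?_⟩
  exact mul_mem (mul_mem (hγ _ i ⟨e, he, .inl rfl⟩) (hc.2 i e he))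
    (inv_mem (hγ _ i ⟨e, he, .inr rfl⟩))

theorem mem_boundaryEdges_zero {e : Edge m n} :
    e ∈ boundaryEdges m n 0 ↔ ∃ y, e = .inr (0, y) := by
  simp [boundaryEdges]

theorem mem_boundaryEdges_one {e : Edge m n} :
    e ∈ boundaryEdges m n 1 ↔ ∃ x, e = .inl (x, Fin.last n) := by
  simp [boundaryEdges]

theorem mem_boundaryEdges_two {e : Edge m n} :
    e ∈ boundaryEdges m n 2 ↔ (∃ x, e = .inl (x, 0)) ∨ ∃ y, e = .inr (Fin.last m, y) := by
  simp [boundaryEdges]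

/-- On a line with at least one edge every vertex is an endpoint of some edge; this turns
`OnBoundary` into conditions on coordinates. -/
theorem exists_succ_or_castSucc {k : ℕ} [NeZero k] (y : Fin (k + 1)) :
    ∃ j : Fin k, j.castSucc = y ∨ j.succ = y := by
  induction y using Fin.cases with
  | zero => exact ⟨0, .inl (by simp)⟩
  | succ j => exact ⟨j, .inr rfl⟩

theorem onBoundary_zero [NeZero n] {v : Vertex m n} : OnBoundary 0 v ↔ v.1 = 0 := by
  constructor
  · rintro ⟨e, he, h⟩
    obtain ⟨y, rfl⟩ := mem_boundaryEdges_zero.1 he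
    rcases h with rfl | rfl <;> rfl
  · rcases v with ⟨x, y⟩
    rintro rfl
    obtain ⟨j, hj⟩ := exists_succ_or_castSucc y
    refine ⟨.inr (0, j), mem_boundaryEdges_zero.2 ⟨_, rfl⟩, ?_⟩
    simpa [src, tgt] using hj

theorem onBoundary_one [NeZero m] {v : Vertex m n} : OnBoundary 1 v ↔ v.2 = Fin.last n := by
  constructor
  · rintro ⟨e, he, h⟩
    obtain ⟨y, rfl⟩ := mem_boundaryEdges_one.1 he
    rcases h with rfl | rfl <;> rfl
  · rcases v with ⟨x, y⟩
    rintro rfl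
    obtain ⟨j, hj⟩ := exists_succ_or_castSucc x
    refine ⟨.inl (j, Fin.last n), mem_boundaryEdges_one.2 ⟨_, rfl⟩, ?_⟩
    simpa [src, tgt] using hj

theorem onBoundary_two [NeZero m] [NeZero n] {v : Vertex m n} :
    OnBoundary 2 v ↔ v.2 = 0 ∨ v.1 = Fin.last m := by
  constructor
  · rintro ⟨e, he, h⟩
    obtain ⟨y, rfl⟩ | ⟨y, rfl⟩ := mem_boundaryEdges_two.1 he
    · rcases h with rfl | rfl <;> exact .inl rfl
    · rcases h with rfl | rfl <;> exact .inr rfl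
  · rcases v with ⟨x, y⟩
    rintro (rfl | rfl)
    · obtain ⟨j, hj⟩ := exists_succ_or_castSucc x
      refine ⟨.inl (j, 0), mem_boundaryEdges_two.2 (.inl ⟨_, rfl⟩), ?_⟩
      simpa [src, tgt] using hj
    · obtain ⟨j, hj⟩ := exists_succ_or_castSucc y
      refine ⟨.inr (Fin.last m, j), mem_boundaryEdges_two.2 (.inr ⟨_, rfl⟩), ?_⟩
      simpa [src, tgt] using hj

/-! ### Sectors -/

section Boundary

variable {K : Fin 3 → Subgroup G} {c : Config G m n}

theorem IsAdmissible.potential_left_mem (hc : IsAdmissible K c) (y : Fin (n + 1)) :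
    potential c (0, y) ∈ K 0 := by
  induction y using Fin.induction with
  | zero => simp
  | succ j ih =>
    rw [← potential_inr]
    exact mul_mem ih (hc.2 0 _ (mem_boundaryEdges_zero.2 ⟨_, rfl⟩))

/-- The top side starts at the upper left corner, where the potential is `g₁` rather than `1`;
dividing it out is necessary because `g₁` need not lie in `K 1`. -/
theorem IsAdmissible.potential_top_mem (hc : IsAdmissible K c) (x : Fin (m + 1)) :
    (potential c (0, Fin.last n))⁻¹ * potential c (x, Fin.last n) ∈ K 1 := by
  induction x using Fin.induction with
  | zero => simp
  | succ j ih =>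
    rw [← hc.1.potential_inl, ← mul_assoc]
    exact mul_mem ih (hc.2 1 _ (mem_boundaryEdges_one.2 ⟨_, rfl⟩))

theorem IsAdmissible.potential_bottom_mem (hc : IsAdmissible K c) (x : Fin (m + 1)) :
    potential c (x, 0) ∈ K 2 := by
  induction x using Fin.induction with
  | zero => simp
  | succ j ih =>
    rw [← hc.1.potential_inl]
    exact mul_mem ih (hc.2 2 _ (mem_boundaryEdges_two.2 (.inl ⟨_, rfl⟩)))

theorem IsAdmissible.potential_right_mem (hc : IsAdmissible K c) (y : Fin (n + 1)) :
    potential c (Fin.last m, y) ∈ K 2 := by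
  induction y using Fin.induction with
  | zero => exact hc.potential_bottom_mem _
  | succ j ih =>
    rw [← potential_inr]
    exact mul_mem ih (hc.2 2 _ (mem_boundaryEdges_two.2 (.inr ⟨_, rfl⟩)))

end Boundary

/-- The admissible configurations whose holonomies along the left and the top side are `g₁` and
`g₂`. -/
def sector (m n : ℕ) (K : Fin 3 → Subgroup G) (g₁ g₂ : G) : Set (Config G m n) :=
  {c | IsAdmissible K c ∧ potential c (0, Fin.last n) = g₁ ∧
    potential c (Fin.last m, Fin.last n) = g₁ * g₂}

theorem IsAdmissible.exists_mem_sector {K : Fin 3 → Subgroup G} {c : Config G m n}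
    (hc : IsAdmissible K c) :
    ∃ g₁ ∈ K 0, ∃ g₂ ∈ K 1, g₁ * g₂ ∈ K 2 ∧ c ∈ sector m n K g₁ g₂ :=
  ⟨_, hc.potential_left_mem _, _, hc.potential_top_mem _,
    by simpa using hc.potential_right_mem _, hc, rfl, by simp⟩

section Corner

variable {K : Fin 3 → Subgroup G}

/-- Each of the three vertices lies on two different sides, so the gauge parameter there is in a
trivial intersection. The lower right vertex is not a corner in this sense: both its edges belong to
the third side. -/
theorem gaugeGroup_corner [NeZero m] [NeZero n] (hK : ∀ i j, i ≠ j → K i ⊓ K j = ⊥)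
    {γ : Vertex m n → G} (hγ : γ ∈ gaugeGroup m n K) :
    γ (0, 0) = 1 ∧ γ (0, Fin.last n) = 1 ∧ γ (Fin.last m, Fin.last n) = 1 := by
  rw [mem_gaugeGroup] at hγ
  have key : ∀ v i j, i ≠ j → OnBoundary i v → OnBoundary j v → γ v = 1 := by
    intro v i j hij hi hj
    rw [← Subgroup.mem_bot, ← hK i j hij]
    exact ⟨hγ v i hi, hγ v j hj⟩
  exact ⟨key _ 0 2 (by decide) (onBoundary_zero.2 rfl) (onBoundary_two.2 (.inl rfl)),
    key _ 0 1 (by decide) (onBoundary_zero.2 rfl) (onBoundary_one.2 rfl),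
    key _ 1 2 (by decide) (onBoundary_one.2 rfl) (onBoundary_two.2 (.inr rfl))⟩

theorem gauge_mem_sector [NeZero m] [NeZero n] (hK : ∀ i j, i ≠ j → K i ⊓ K j = ⊥)
    {γ : Vertex m n → G} (hγ : γ ∈ gaugeGroup m n K) {g₁ g₂ : G} {c : Config G m n}
    (hc : c ∈ sector m n K g₁ g₂) : gauge γ c ∈ sector m n K g₁ g₂ := by
  obtain ⟨h0, h1, h2⟩ := gaugeGroup_corner hK hγ
  refine ⟨hc.1.gauge hγ, ?_, ?_⟩
  · rw [hc.1.1.potential_gauge, h0, h1, hc.2.1]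
    simp
  · rw [hc.1.1.potential_gauge, h0, h2, hc.2.2]
    simp

/-- The required `γ` is the quotient of the two potentials. It respects the boundaries because both
potentials lie in the same subgroup, or on the top side in the same coset `g₁ K 1`, where the common
factor `g₁` cancels. -/
theorem exists_gauge_eq [NeZero m] [NeZero n] {g₁ g₂ : G} {c c' : Config G m n}
    (hc : c ∈ sector m n K g₁ g₂) (hc' : c' ∈ sector m n K g₁ g₂) :
    ∃ γ ∈ gaugeGroup m n K, gauge γ c = c' := by
  refine ⟨fun v => (potential c' v)⁻¹ * potential c v, ?_, ?_⟩
  · rw [mem_gaugeGroup]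
    rintro ⟨x, y⟩ i hi
    fin_cases i
    · obtain rfl : x = 0 := onBoundary_zero.1 hi
      exact mul_mem (inv_mem (hc'.1.potential_left_mem y)) (hc.1.potential_left_mem y)
    · obtain rfl : y = Fin.last n := onBoundary_one.1 hi
      have h := mul_mem (inv_mem (hc'.1.potential_top_mem x)) (hc.1.potential_top_mem x)
      rw [hc'.2.1, hc.2.1] at h
      simpa [mul_assoc] using h
    · obtain rfl | rfl : y = 0 ∨ x = Fin.last m := onBoundary_two.1 hi
      · exact mul_mem (inv_mem (hc'.1.potential_bottom_mem x)) (hc.1.potential_bottom_mem x)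
      · exact mul_mem (inv_mem (hc'.1.potential_right_mem y)) (hc.1.potential_right_mem y)
  · funext e
    have h := hc.1.1.potential_src_mul e
    have h' := hc'.1.1.potential_src_mul e
    simp only [gauge]
    rw [← h, ← h']
    simp [mul_assoc]

/-- With `γ = 1` at the origin, the potential of the transformed labelling is `potential c v * (γ
v)⁻¹`, from which `γ` can be read off. -/
theorem gauge_injective [NeZero m] [NeZero n] (hK : ∀ i j, i ≠ j → K i ⊓ K j = ⊥)
    {γ δ : Vertex m n → G} (hγ : γ ∈ gaugeGroup m n K) (hδ : δ ∈ gaugeGroup m n K)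
    {c : Config G m n} (hc : IsFlat c) (h : gauge γ c = gauge δ c) : γ = δ := by
  funext v
  have := hc.potential_gauge γ v
  rw [h, hc.potential_gauge, (gaugeGroup_corner hK hγ).1, (gaugeGroup_corner hK hδ).1] at this
  exact (inv_injective (mul_left_cancel this)).symm

end Corner

/-! ### Ribbon configurations -/

/-- A potential of the configuration of three ribbons ending in the plaquette `p`. -/
def ribbonPotential (p : Plaquette m n) (g₁ g₂ : G) (v : Vertex m n) : G :=
  if v.1 ≤ p.1.castSucc then if v.2 ≤ p.2.castSucc then 1 else g₁ else g₁ * g₂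

/-- The configuration obtained from the trivial one by multiplying by `g₁`, `g₂`, `g₁ g₂` on the
three ribbons ending in `p`. -/
def ribbonConfig (p : Plaquette m n) (g₁ g₂ : G) : Config G m n :=
  fun e => (ribbonPotential p g₁ g₂ (src e))⁻¹ * ribbonPotential p g₁ g₂ (tgt e)

theorem ribbonPotential_src_mul (p : Plaquette m n) (g₁ g₂ : G) (e : Edge m n) :
    ribbonPotential p g₁ g₂ (src e) * ribbonConfig p g₁ g₂ e = ribbonPotential p g₁ g₂ (tgt e) :=
  mul_inv_cancel_left _ _

theorem ribbonConfig_mem_sector {K : Fin 3 → Subgroup G} (p : Plaquette m n) {g₁ g₂ : G}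
    (h₁ : g₁ ∈ K 0) (h₂ : g₂ ∈ K 1) (h₃ : g₁ * g₂ ∈ K 2) :
    ribbonConfig p g₁ g₂ ∈ sector m n K g₁ g₂ := by
  have hpot : ∀ v, potential (ribbonConfig p g₁ g₂) v = ribbonPotential p g₁ g₂ v := by
    intro v
    rw [eq_mul_potential (ribbonPotential_src_mul p g₁ g₂) v]
    simp [ribbonPotential]
  have e1 : ¬ Fin.last m ≤ p.1.castSucc := by simp [Fin.le_def]
  have e2 : ¬ Fin.last n ≤ p.2.castSucc := by simp [Fin.le_def]
  refine ⟨⟨isFlat_of_potential (ribbonPotential_src_mul p g₁ g₂), ?_⟩, ?_, ?_⟩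
  · intro i e he
    fin_cases i
    · obtain ⟨y, rfl⟩ := mem_boundaryEdges_zero.1 he
      have : ∀ y, ribbonPotential p g₁ g₂ (0, y) ∈ K 0 := by
        intro y
        simp only [ribbonPotential, Fin.zero_le, if_true]
        split_ifs
        exacts [one_mem _, h₁]
      exact mul_mem (inv_mem (this _)) (this _)
    · obtain ⟨x, rfl⟩ := mem_boundaryEdges_one.1 he
      have : ∀ x, g₁⁻¹ * ribbonPotential p g₁ g₂ (x, Fin.last n) ∈ K 1 := by
        intro x
        simp only [ribbonPotential, e2, if_false]
        split_ifs <;> simp [h₂]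
      have h := mul_mem (inv_mem (this x.castSucc)) (this x.succ)
      simpa [mul_assoc, ribbonConfig, src, tgt] using h
    · have : ∀ v : Vertex m n, v.2 = 0 ∨ v.1 = Fin.last m → ribbonPotential p g₁ g₂ v ∈ K 2 := by
        rintro ⟨x, y⟩ (rfl | rfl)
        · simp only [ribbonPotential, Fin.zero_le, if_true]
          split_ifs
          exacts [one_mem _, h₃]
        · simpa only [ribbonPotential, e1, if_false] using h₃
      obtain ⟨x, rfl⟩ | ⟨y, rfl⟩ := mem_boundaryEdges_two.1 he
      · exact mul_mem (inv_mem (this _ (.inl rfl))) (this _ (.inl rfl))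
      · exact mul_mem (inv_mem (this _ (.inr rfl))) (this _ (.inr rfl))
  · rw [hpot]
    simp [ribbonPotential, e2]
  · rw [hpot]
    simp [ribbonPotential, e1]

/-- The three ribbons cut the vertices into three regions on which `ribbonPotential` is `1`, `g₁`
and `g₁ * g₂`; a label differs from `1` only across a cut. The left side has the shape left by
composing the three maps of `leftMulOp`. -/
theorem leftMul_ribbons (p : Plaquette m n) (g₁ g₂ : G) :
    (fun e => if e ∈ ribbon p 0 then g₁ * (fun e => if e ∈ ribbon p 1 then
      g₂ * (fun e => if e ∈ ribbon p 2 then (g₁ * g₂) * (1 : Config G m n) e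
        else (1 : Config G m n) e) e
      else (fun e => if e ∈ ribbon p 2 then (g₁ * g₂) * (1 : Config G m n) e
        else (1 : Config G m n) e) e) e
      else (fun e => if e ∈ ribbon p 1 then
      g₂ * (fun e => if e ∈ ribbon p 2 then (g₁ * g₂) * (1 : Config G m n) e
        else (1 : Config G m n) e) e
      else (fun e => if e ∈ ribbon p 2 then (g₁ * g₂) * (1 : Config G m n) e
        else (1 : Config G m n) e) e) e) = ribbonConfig p g₁ g₂ := by
  obtain ⟨p1, p2⟩ := p
  funext e
  rcases e with ⟨x, y⟩ | ⟨x, y⟩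
  · have h0 : (Sum.inl (x, y) : Edge m n) ∉ ribbon (p1, p2) 0 := by simp [ribbon]
    have h1 : (Sum.inl (x, y) : Edge m n) ∈ ribbon (p1, p2) 1 ↔ p2.succ ≤ y ∧ x = p1 := by
      simp [ribbon]
    have h2 : (Sum.inl (x, y) : Edge m n) ∈ ribbon (p1, p2) 2 ↔ y ≤ p2.castSucc ∧ x = p1 := by
      simp [ribbon]
    simp only [h0, h1, h2, if_false, ribbonConfig, ribbonPotential, src, tgt, Pi.one_apply,
      Fin.le_def, Fin.val_castSucc, Fin.val_succ, Fin.ext_iff]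
    -- `omega` removes the inconsistent positions of the edge relative to `p`; `simp` computes the
    -- label in the others.
    split_ifs <;> first | omega | simp
  · have h0 : (Sum.inr (x, y) : Edge m n) ∈ ribbon (p1, p2) 0 ↔ x ≤ p1.castSucc ∧ y = p2 := by
      simp [ribbon]
    have h1 : (Sum.inr (x, y) : Edge m n) ∉ ribbon (p1, p2) 1 := by simp [ribbon]
    have h2 : (Sum.inr (x, y) : Edge m n) ∉ ribbon (p1, p2) 2 := by simp [ribbon]
    simp only [h0, h1, h2, if_false, ribbonConfig, ribbonPotential, src, tgt, Pi.one_apply,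
      Fin.le_def, Fin.val_castSucc, Fin.val_succ, Fin.ext_iff]
    split_ifs <;> first | omega | simp

end QuantumDouble

noncomputable section

set_option linter.unusedSectionVars false

namespace QuantumDouble

variable {m n : ℕ} {G : Type} [Group G] [Fintype G] [DecidableEq G]

/-! ### The projector onto gauge invariant states -/

theorem mapOp_mulVec_ket (f : Config G m n → Config G m n) (c : Config G m n) :
    mapOp f *ᵥ ket c = ket (f c) := by
  ext c'
  simp [mapOp, ket, Pi.single_apply]

theorem mapOp_gauge_mulVec (γ : Vertex m n → G) (ψ : State G m n) (c : Config G m n) :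
    (mapOp (gauge γ) *ᵥ ψ) c = ψ (gauge γ⁻¹ c) := by
  simp only [Matrix.mulVec, dotProduct, mapOp, Matrix.of_apply, ite_mul, one_mul, zero_mul]
  rw [Finset.sum_eq_single (gauge γ⁻¹ c)]
  · rw [if_pos (gauge_gauge_inv γ c).symm]
  · rintro b - hb
    refine if_neg fun h => hb ?_
    rw [h, gauge_inv_gauge]
  · simp

theorem mapOp_gauge_mul (γ δ : Vertex m n → G) :
    mapOp (gauge γ) * mapOp (gauge δ) = mapOp (gauge (m := m) (n := n) (γ * δ)) := by
  rw [mapOp_mul, gauge_comp]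

theorem mapOp_gauge_one : mapOp (gauge (1 : Vertex m n → G)) = 1 := by
  ext c c'
  simp [mapOp, gauge_one, Matrix.one_apply]

theorem vertexOp_mul (v : Vertex m n) (g h : G) :
    vertexOp v g * vertexOp v h = vertexOp v (g * h) := by
  simp only [vertexOp, mapOp_gauge_mul, Pi.mulSingle_mul]

theorem vertexOp_mul_vertexProj {K : Fin 3 → Subgroup G} {v : Vertex m n} {g : G}
    (hg : g ∈ vertexGroup K v) : vertexOp v g * vertexProj K v = vertexProj K v := by
  classical
  unfold vertexProj
  rw [Matrix.mul_smul, Finset.mul_sum]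
  congr 1
  refine Finset.sum_equiv (Equiv.mulLeft g) (fun h => ?_) fun h _ => ?_
  · simp [Subgroup.mul_mem_cancel_left _ hg]
  · rw [vertexOp_mul, Equiv.coe_mulLeft]

theorem card_vertexGroup_ne_zero {K : Fin 3 → Subgroup G} {v : Vertex m n}
    [DecidablePred fun g : G => g ∈ vertexGroup K v] :
    ((Finset.univ.filter fun g : G => g ∈ vertexGroup K v).card : ℂ) ≠ 0 := by
  rw [Nat.cast_ne_zero]
  exact Finset.card_ne_zero_of_mem (Finset.mem_filter.2 ⟨Finset.mem_univ _, one_mem _⟩)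

theorem vertexProj_mulVec_of_fixed {K : Fin 3 → Subgroup G} {v : Vertex m n} {ψ : State G m n}
    (h : ∀ g ∈ vertexGroup K v, vertexOp v g *ᵥ ψ = ψ) : vertexProj K v *ᵥ ψ = ψ := by
  classical
  unfold vertexProj
  rw [Matrix.smul_mulVec, Matrix.sum_mulVec,
    Finset.sum_congr rfl fun g hg => h g (Finset.mem_filter.1 hg).2, Finset.sum_const,
    ← Nat.cast_smul_eq_nsmul ℂ, smul_smul, inv_mul_cancel₀ card_vertexGroup_ne_zero, one_smul]

theorem vertexProj_mul_self (K : Fin 3 → Subgroup G) (v : Vertex m n) :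
    vertexProj K v * vertexProj K v = vertexProj K v := by
  apply Matrix.ext_of_mulVec_single
  intro c
  rw [← Matrix.mulVec_mulVec]
  refine vertexProj_mulVec_of_fixed fun g hg => ?_
  rw [Matrix.mulVec_mulVec, vertexOp_mul_vertexProj hg]

theorem vertexProjProd_mul_vertexProj (K : Fin 3 → Subgroup G) (v : Vertex m n) :
    vertexProjProd m n K * vertexProj K v = vertexProjProd m n K := by
  have h : _ * vertexProj K v = vertexProjProd m n K :=
    Finset.noncommProd_erase_mul Finset.univ (Finset.mem_univ v) (fun v => vertexProj K v)
      fun _ _ _ _ h => vertexProj_commute K h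
  rw [← h, mul_assoc, vertexProj_mul_self]

theorem mulSingle_mem_gaugeGroup {K : Fin 3 → Subgroup G} {v : Vertex m n} {g : G}
    (hg : g ∈ vertexGroup K v) : Pi.mulSingle v g ∈ gaugeGroup m n K := by
  intro w _
  obtain rfl | hw := eq_or_ne w v
  · simpa using hg
  · simp [hw]

theorem vertexProjProd_mulVec_of_fixed {K : Fin 3 → Subgroup G} {ψ : State G m n}
    (h : ∀ v, vertexProj K v *ᵥ ψ = ψ) : vertexProjProd m n K *ᵥ ψ = ψ := by
  unfold vertexProjProd
  refine Finset.noncommProd_induction _ _ _ (fun M => M *ᵥ ψ = ψ) ?_ ?_ ?_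
  · intro A B hA hB
    rw [← Matrix.mulVec_mulVec, hB, hA]
  · exact Matrix.one_mulVec _
  · exact fun v _ => h v

/-- The gauge transformations fixing `ψ` form a subgroup, and the gauge group, a finite product, is
generated by its factors at single vertices. -/
theorem mapOp_gauge_mulVec_of_fixed {K : Fin 3 → Subgroup G} {ψ : State G m n}
    (h : ∀ v, vertexProj K v *ᵥ ψ = ψ) {γ : Vertex m n → G} (hγ : γ ∈ gaugeGroup m n K) :
    mapOp (gauge γ) *ᵥ ψ = ψ := by
  let J : Subgroup (Vertex m n → G) :=
    { carrier := {γ | mapOp (gauge γ) *ᵥ ψ = ψ}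
      mul_mem' := by
        intro a b ha hb
        rw [Set.mem_ofPred_eq] at ha hb ⊢
        rw [← mapOp_gauge_mul, ← Matrix.mulVec_mulVec, hb, ha]
      one_mem' := by
        rw [Set.mem_ofPred_eq, mapOp_gauge_one, Matrix.one_mulVec]
      inv_mem' := by
        intro a ha
        rw [Set.mem_ofPred_eq] at ha ⊢
        conv_lhs => rw [← ha]
        rw [Matrix.mulVec_mulVec, mapOp_gauge_mul, inv_mul_cancel, mapOp_gauge_one,
          Matrix.one_mulVec] }
  suffices gaugeGroup m n K ≤ J from this hγ
  refine Subgroup.pi_le_iff.2 fun v => ?_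
  rintro _ ⟨g, hg, rfl⟩
  change vertexOp v g *ᵥ ψ = ψ
  rw [← h v, Matrix.mulVec_mulVec, vertexOp_mul_vertexProj hg]

theorem vertexProj_mulVec_iff {K : Fin 3 → Subgroup G} {ψ : State G m n} :
    (∀ v, vertexProj K v *ᵥ ψ = ψ) ↔ ∀ γ ∈ gaugeGroup m n K, ∀ c, ψ (gauge γ c) = ψ c := by
  constructor
  · intro h γ hγ c
    have := congrFun (mapOp_gauge_mulVec_of_fixed h (inv_mem hγ)) c
    rwa [mapOp_gauge_mulVec, inv_inv] at this
  · intro h v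
    refine vertexProj_mulVec_of_fixed fun g hg => ?_
    funext c
    rw [vertexOp, mapOp_gauge_mulVec]
    exact h _ (inv_mem (mulSingle_mem_gaugeGroup hg)) c

/-- The plaquette and boundary terms are diagonal with entries `0` and `1`, so being fixed by them
is a condition on the support; being fixed by all vertex terms is gauge invariance. -/
theorem mem_codeSpace_iff {K : Fin 3 → Subgroup G} {ψ : State G m n} :
    ψ ∈ codeSpace m n K ↔ (∀ γ ∈ gaugeGroup m n K, ∀ c, ψ (gauge γ c) = ψ c) ∧
      ∀ c, ψ c ≠ 0 → IsAdmissible K c := by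
  classical
  have h1 : (∀ p, plaquetteOp p 1 *ᵥ ψ = ψ) ↔ ∀ c, ψ c ≠ 0 → IsFlat c := by
    have key : ∀ (p : Plaquette m n) (c : Config G m n),
        (plaquetteOp p 1 *ᵥ ψ) c = ψ c ↔ (ψ c ≠ 0 →
          c (leftEdge p) * c (topEdge p) = c (bottomEdge p) * c (rightEdge p)) := by
      intro p c
      have : c (leftEdge p) * c (topEdge p) * (c (rightEdge p))⁻¹ * (c (bottomEdge p))⁻¹ = 1 ↔
          c (leftEdge p) * c (topEdge p) = c (bottomEdge p) * c (rightEdge p) := by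
        rw [mul_inv_eq_one, mul_inv_eq_iff_eq_mul]
      simp only [plaquetteOp, Matrix.mulVec_diagonal, this]
      split_ifs with hc
      · simp [hc]
      · simp [hc, eq_comm]
    simp only [funext_iff, key, IsFlat]
    exact ⟨fun h c hc p => h p c hc, fun h p c hc => h c hc p⟩
  have h2 : (∀ i, ∀ e ∈ boundaryEdges m n i, boundaryProj (K i) e *ᵥ ψ = ψ) ↔
      ∀ c, ψ c ≠ 0 → ∀ i, ∀ e ∈ boundaryEdges m n i, c e ∈ K i := by
    have key : ∀ (i) (e : Edge m n) (c : Config G m n),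
        (boundaryProj (K i) e *ᵥ ψ) c = ψ c ↔ (ψ c ≠ 0 → c e ∈ K i) := by
      intro i e c
      simp only [boundaryProj, Matrix.mulVec_diagonal]
      split_ifs with hc
      · simp [hc]
      · simp [hc, eq_comm]
    simp only [funext_iff, key]
    exact ⟨fun h c hc i e he => h i e he c hc, fun h i e he c hc => h c hc i e he⟩
  change ((∀ v, _) ∧ (∀ p, _) ∧ ∀ i, _) ↔ _
  rw [vertexProj_mulVec_iff, h1, h2]
  simp only [IsAdmissible]
  exact and_congr_right fun _ => ⟨fun h c hc => ⟨h.1 c hc, h.2 c hc⟩,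
    fun h => ⟨fun c hc => (h c hc).1, fun c hc => (h c hc).2⟩⟩

open Classical in
-- The noncommutative product `P` need not be expanded. The orbit average `Q` is gauge invariant, so
-- `P Q = Q`; and `P` absorbs gauge transformations on its right, so every term of `Q` has the same
-- image `P |c⟩`. Hence `Q = P |c⟩`.
theorem vertexProjProd_mulVec_ket (K : Fin 3 → Subgroup G) (c : Config G m n) :
    vertexProjProd m n K *ᵥ ket c =
      (Nat.card (gaugeGroup m n K) : ℂ)⁻¹ • ∑ γ : gaugeGroup m n K, ket (gauge (γ : _ → G) c) := by
  set P := vertexProjProd m n K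
  set Q : State G m n := (Nat.card (gaugeGroup m n K) : ℂ)⁻¹ •
    ∑ γ : gaugeGroup m n K, ket (gauge (γ : _ → G) c)
  have card0 : (Nat.card (gaugeGroup m n K) : ℂ) ≠ 0 := Nat.cast_ne_zero.2 Nat.card_pos.ne'
  have hQ : P *ᵥ Q = Q := by
    refine vertexProjProd_mulVec_of_fixed fun v => vertexProj_mulVec_of_fixed fun g hg => ?_
    have hm := mulSingle_mem_gaugeGroup hg
    simp only [Q, Matrix.mulVec_smul, Matrix.mulVec_sum, vertexOp, mapOp_mulVec_ket, ← gauge_mul]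
    congr 1
    refine Fintype.sum_equiv (Equiv.mulLeft (⟨_, hm⟩ : gaugeGroup m n K)) _ _ fun γ => ?_
    rw [Equiv.coe_mulLeft, Subgroup.coe_mul]
  have hcomm : ∀ γ : Vertex m n → G, γ ∈ gaugeGroup m n K →
      P * mapOp (gauge γ) = P := by
    intro γ hγ
    have hle : gaugeGroup m n K ≤ ({
        carrier := {γ | P * mapOp (gauge γ) = P}
        mul_mem' := by
          intro a b ha hb
          rw [Set.mem_ofPred_eq] at ha hb ⊢
          rw [← mapOp_gauge_mul, ← mul_assoc, ha, hb]
        one_mem' := by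
          rw [Set.mem_ofPred_eq, mapOp_gauge_one, mul_one]
        inv_mem' := by
          intro a ha
          rw [Set.mem_ofPred_eq] at ha ⊢
          conv_lhs => rw [← ha]
          rw [mul_assoc, mapOp_gauge_mul, mul_inv_cancel, mapOp_gauge_one, mul_one] } :
          Subgroup (Vertex m n → G)) := by
      refine Subgroup.pi_le_iff.2 fun v => ?_
      rintro _ ⟨g, hg, rfl⟩
      change P * vertexOp v g = P
      have : vertexProj K v * vertexOp v g = vertexProj K v := by
        unfold vertexProj
        rw [Matrix.smul_mul, Finset.sum_mul]
        congr 1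
        refine Finset.sum_equiv (Equiv.mulRight g) (fun h => ?_) fun h _ => ?_
        · simp [Subgroup.mul_mem_cancel_right _ hg]
        · rw [vertexOp_mul, Equiv.coe_mulRight]
      have hP : P * vertexProj K v = P := vertexProjProd_mul_vertexProj K v
      rw [← hP, mul_assoc, this]
    exact hle hγ
  rw [← hQ]
  simp only [Q, Matrix.mulVec_smul, Matrix.mulVec_sum]
  have : ∀ γ : gaugeGroup m n K, P *ᵥ ket (gauge (γ : _ → G) c) = P *ᵥ ket c := fun γ => by
    rw [← mapOp_mulVec_ket, Matrix.mulVec_mulVec, hcomm _ γ.2]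
  rw [Finset.sum_congr rfl fun γ _ => this γ, Finset.sum_const, Finset.card_univ,
    ← Nat.card_eq_fintype_card, ← Nat.cast_smul_eq_nsmul ℂ, smul_smul, inv_mul_cancel₀ card0,
    one_smul]

/-! ### The logical states -/

section Logical

variable {K : Fin 3 → Subgroup G} {g₁ g₂ : G}

open Classical in
-- The ribbon operators create one labelling of the sector, and averaging over a simply transitive
-- action reaches every other one exactly once.
theorem magneticState_apply (hK : ∀ i j, i ≠ j → K i ⊓ K j = ⊥) (p : Plaquette m n)
    (h₁ : g₁ ∈ K 0) (h₂ : g₂ ∈ K 1) (h₃ : g₁ * g₂ ∈ K 2) (c : Config G m n) :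
    magneticState K p g₁ g₂ c =
      if c ∈ sector m n K g₁ g₂ then (Nat.card (gaugeGroup m n K) : ℂ)⁻¹ else 0 := by
  -- The existence of the plaquette `p` forces `m` and `n` to be positive.
  have : NeZero m := ⟨(Fin.pos p.1).ne'⟩
  have : NeZero n := ⟨(Fin.pos p.2).ne'⟩
  have hr := ribbonConfig_mem_sector p h₁ h₂ h₃
  have h : magneticState K p g₁ g₂ = vertexProjProd m n K *ᵥ ket (ribbonConfig p g₁ g₂) := by
    rw [magneticState, ← Matrix.mulVec_mulVec, ← Matrix.mulVec_mulVec, ← Matrix.mulVec_mulVec]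
    congr 1
    simp only [leftMulOp, mapOp_mulVec_ket]
    rw [← leftMul_ribbons p g₁ g₂]
  rw [h, vertexProjProd_mulVec_ket, Pi.smul_apply, Finset.sum_apply, smul_eq_mul]
  split_ifs with hc
  · obtain ⟨γ, hγ, hγc⟩ := exists_gauge_eq hr hc
    rw [Finset.sum_eq_single (⟨γ, hγ⟩ : gaugeGroup m n K)]
    · simp [ket, hγc]
    · rintro δ - hδ
      rw [ket, Pi.single_apply, if_neg]
      intro h'
      exact hδ (Subtype.ext (gauge_injective hK δ.2 hγ hr.1.1 (h'.symm.trans hγc.symm)))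
    · simp
  · rw [Finset.sum_eq_zero, mul_zero]
    rintro γ -
    rw [ket, Pi.single_apply, if_neg]
    rintro rfl
    exact hc (gauge_mem_sector hK γ.2 hr)

theorem card_sector (hK : ∀ i j, i ≠ j → K i ⊓ K j = ⊥) (p : Plaquette m n)
    (h₁ : g₁ ∈ K 0) (h₂ : g₂ ∈ K 1) (h₃ : g₁ * g₂ ∈ K 2) :
    Nat.card (sector m n K g₁ g₂) = Nat.card (gaugeGroup m n K) := by
  have : NeZero m := ⟨(Fin.pos p.1).ne'⟩
  have : NeZero n := ⟨(Fin.pos p.2).ne'⟩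
  have hr := ribbonConfig_mem_sector p h₁ h₂ h₃
  symm
  refine Nat.card_eq_of_bijective
    (fun γ : gaugeGroup m n K => (⟨_, gauge_mem_sector hK γ.2 hr⟩ : sector m n K g₁ g₂)) ⟨?_, ?_⟩
  · intro γ δ h
    exact Subtype.ext (gauge_injective hK γ.2 δ.2 hr.1.1 (Subtype.ext_iff.1 h))
  · rintro ⟨c, hc⟩
    obtain ⟨γ, hγ, hγc⟩ := exists_gauge_eq hr hc
    exact ⟨⟨γ, hγ⟩, Subtype.ext hγc⟩

theorem star_magneticState_dotProduct_self (hK : ∀ i j, i ≠ j → K i ⊓ K j = ⊥)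
    (p : Plaquette m n) (h₁ : g₁ ∈ K 0) (h₂ : g₂ ∈ K 1) (h₃ : g₁ * g₂ ∈ K 2) :
    star (magneticState K p g₁ g₂) ⬝ᵥ magneticState K p g₁ g₂ =
      (Nat.card (gaugeGroup m n K) : ℂ)⁻¹ := by
  classical
  have card0 : (Nat.card (gaugeGroup m n K) : ℂ) ≠ 0 := Nat.cast_ne_zero.2 Nat.card_pos.ne'
  have : ∀ c, star (magneticState K p g₁ g₂) c * magneticState K p g₁ g₂ c =
      if c ∈ sector m n K g₁ g₂ then
        (Nat.card (gaugeGroup m n K) : ℂ)⁻¹ * (Nat.card (gaugeGroup m n K) : ℂ)⁻¹ else 0 := by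
    intro c
    rw [Pi.star_apply, magneticState_apply hK p h₁ h₂ h₃]
    split_ifs <;> simp
  rw [dotProduct, Finset.sum_congr rfl fun c _ => this c, ← Finset.sum_filter, Finset.sum_const,
    nsmul_eq_mul]
  have hcard : (Finset.univ.filter fun c => c ∈ sector m n K g₁ g₂).card =
      Nat.card (gaugeGroup m n K) := by
    rw [← card_sector hK p h₁ h₂ h₃, Nat.card_eq_fintype_card, Fintype.card_subtype]
  rw [hcard, ← mul_assoc, mul_inv_cancel₀ card0, one_mul]

theorem magneticState_ne_zero (hK : ∀ i j, i ≠ j → K i ⊓ K j = ⊥)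
    (p : Plaquette m n) (h₁ : g₁ ∈ K 0) (h₂ : g₂ ∈ K 1) (h₃ : g₁ * g₂ ∈ K 2) :
    magneticState K p g₁ g₂ ≠ 0 := by
  intro h
  have := star_magneticState_dotProduct_self hK p h₁ h₂ h₃
  rw [h, dotProduct_zero, eq_comm, inv_eq_zero, Nat.cast_eq_zero] at this
  exact Nat.card_pos.ne' this

theorem star_magneticState_dotProduct (hK : ∀ i j, i ≠ j → K i ⊓ K j = ⊥)
    (p : Plaquette m n) (h₁ : g₁ ∈ K 0) (h₂ : g₂ ∈ K 1) (h₃ : g₁ * g₂ ∈ K 2) {k₁ k₂ : G}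
    (h₁' : k₁ ∈ K 0) (h₂' : k₂ ∈ K 1) (h₃' : k₁ * k₂ ∈ K 2) (hne : g₁ ≠ k₁) :
    star (magneticState K p g₁ g₂) ⬝ᵥ magneticState K p k₁ k₂ = 0 := by
  classical
  refine Finset.sum_eq_zero fun c _ => ?_
  rw [Pi.star_apply, magneticState_apply hK p h₁ h₂ h₃, magneticState_apply hK p h₁' h₂' h₃']
  split_ifs with h h'
  · exact absurd (h.2.1.symm.trans h'.2.1) hne
  all_goals simp

/-- A code state is constant on sectors and vanishes off them, and by the last hypothesis there are
only the two sectors. -/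
theorem codeSpace_eq_span_pair (hK : ∀ i j, i ≠ j → K i ⊓ K j = ⊥) (p : Plaquette m n)
    (h₁ : g₁ ∈ K 0) (h₂ : g₂ ∈ K 1) (h₃ : g₁ * g₂ ∈ K 2) (hne : g₁ ≠ 1)
    (h : ∀ k₁ ∈ K 0, ∀ k₂ ∈ K 1, k₁ * k₂ ∈ K 2 → (k₁ = 1 ∧ k₂ = 1) ∨ (k₁ = g₁ ∧ k₂ = g₂)) :
    codeSpace m n K = Submodule.span ℂ {magneticState K p 1 1, magneticState K p g₁ g₂} := by
  classical
  have : NeZero m := ⟨(Fin.pos p.1).ne'⟩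
  have : NeZero n := ⟨(Fin.pos p.2).ne'⟩
  have card0 : (Nat.card (gaugeGroup m n K) : ℂ) ≠ 0 := Nat.cast_ne_zero.2 Nat.card_pos.ne'
  have h₃1 : (1 : G) * 1 ∈ K 2 := by simp
  apply le_antisymm
  · intro ψ hψ
    rw [mem_codeSpace_iff] at hψ
    obtain ⟨hinv, hsupp⟩ := hψ
    have key : ∀ {k₁ k₂ : G} {c c' : Config G m n}, c ∈ sector m n K k₁ k₂ →
        c' ∈ sector m n K k₁ k₂ → ψ c' = ψ c := by
      intro k₁ k₂ c c' hc hc'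
      obtain ⟨γ, hγ, rfl⟩ := exists_gauge_eq hc hc'
      exact hinv γ hγ c
    -- The factor `Nat.card (gaugeGroup m n K)` undoes the amplitude of the unnormalized magnetic
    -- states.
    refine Submodule.mem_span_pair.2
      ⟨Nat.card (gaugeGroup m n K) * ψ (ribbonConfig p 1 1),
        Nat.card (gaugeGroup m n K) * ψ (ribbonConfig p g₁ g₂), ?_⟩
    funext c
    simp only [Pi.add_apply, Pi.smul_apply, smul_eq_mul,
      magneticState_apply hK p (one_mem _) (one_mem _) h₃1, magneticState_apply hK p h₁ h₂ h₃]
    by_cases hc : IsAdmissible K c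
    · obtain ⟨k₁, hk₁, k₂, hk₂, hk, hck⟩ := hc.exists_mem_sector
      rcases h k₁ hk₁ k₂ hk₂ hk with ⟨rfl, rfl⟩ | ⟨rfl, rfl⟩
      · have : c ∉ sector m n K g₁ g₂ := fun hc' => hne (hc'.2.1.symm.trans hck.2.1)
        rw [if_pos hck, if_neg this, mul_zero, add_zero, mul_right_comm, mul_inv_cancel₀ card0,
          one_mul, key hck (ribbonConfig_mem_sector p (one_mem _) (one_mem _) h₃1)]
      · have : c ∉ sector m n K 1 1 := fun hc' => hne (hck.2.1.symm.trans hc'.2.1)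
        rw [if_pos hck, if_neg this, mul_zero, zero_add, mul_right_comm, mul_inv_cancel₀ card0,
          one_mul, key hck (ribbonConfig_mem_sector p h₁ h₂ h₃)]
    · rw [if_neg fun h => hc h.1, if_neg fun h => hc h.1, mul_zero, mul_zero, add_zero]
      exact (not_not.1 fun h0 => hc (hsupp c h0)).symm
  · have hmem : ∀ {k₁ k₂ : G}, k₁ ∈ K 0 → k₂ ∈ K 1 → k₁ * k₂ ∈ K 2 →
        magneticState K p k₁ k₂ ∈ codeSpace m n K := by
      intro k₁ k₂ hk₁ hk₂ hk
      rw [mem_codeSpace_iff]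
      refine ⟨fun γ hγ c => ?_, fun c hc => ?_⟩
      · have : gauge γ c ∈ sector m n K k₁ k₂ ↔ c ∈ sector m n K k₁ k₂ := by
          refine ⟨fun h' => ?_, gauge_mem_sector hK hγ⟩
          rw [← gauge_inv_gauge γ c]
          exact gauge_mem_sector hK (inv_mem hγ) h'
        simp only [magneticState_apply hK p hk₁ hk₂ hk, this]
      · rw [magneticState_apply hK p hk₁ hk₂ hk] at hc
        exact (not_not.1 fun h0 => hc (if_neg h0)).1
    rw [Submodule.span_le]
    rintro _ (rfl | rfl)
    · exact hmem (one_mem _) (one_mem _) h₃1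
    · exact hmem h₁ h₂ h₃

/-- A diagonal operator that is constant on a sector acts on its state as a scalar. -/
theorem diagonal_mulVec_magneticState (hK : ∀ i j, i ≠ j → K i ⊓ K j = ⊥) (p : Plaquette m n)
    (h₁ : g₁ ∈ K 0) (h₂ : g₂ ∈ K 1) (h₃ : g₁ * g₂ ∈ K 2) {d : Config G m n → ℂ} {a : ℂ}
    (h : ∀ c ∈ sector m n K g₁ g₂, d c = a) :
    Matrix.diagonal d *ᵥ magneticState K p g₁ g₂ = a • magneticState K p g₁ g₂ := by
  classical
  funext c
  rw [Matrix.mulVec_diagonal, Pi.smul_apply, smul_eq_mul, magneticState_apply hK p h₁ h₂ h₃]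
  split_ifs with hc
  · rw [h c hc]
  · simp

end Logical

end QuantumDouble

end

noncomputable section

set_option linter.unusedSectionVars false

namespace QuantumDouble

variable {m n : ℕ} {G : Type} [Group G] [Fintype G] [DecidableEq G]

/-! ### The electric triangle -/

/-- Each path contributes the change of a character of the potential: `χ₁ (φ v)` from the left side,
`χ₂ g₁ / χ₂ (φ v)` to the top and `1 / χ₃ (φ v)` to the right. Since `χ₁ = χ₃ χ₂`, the dependence on
`v` cancels. -/
theorem electricOp_mulVec_magneticState {K : Fin 3 → Subgroup G} {g₁ g₂ : G}
    (hK : ∀ i j, i ≠ j → K i ⊓ K j = ⊥) (p : Plaquette m n)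
    (h₁ : g₁ ∈ K 0) (h₂ : g₂ ∈ K 1) (h₃ : g₁ * g₂ ∈ K 2) {χ₁ χ₂ χ₃ : G → ℂ}
    (hχ₂ : ∀ g h, χ₂ (g * h) = χ₂ g * χ₂ h) (hχ₃ : ∀ g h, χ₃ (g * h) = χ₃ g * χ₃ h)
    (hχ₁ : ∀ g, χ₁ g = χ₃ g * χ₂ g) (hK₁ : ∀ g ∈ K 0, χ₁ g = 1) (hK₂ : ∀ g ∈ K 1, χ₂ g = 1)
    (hK₃ : ∀ g ∈ K 2, χ₃ g = 1) (v : Vertex m n) :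
    electricOp χ₁ χ₂ χ₃ v *ᵥ magneticState K p g₁ g₂ = χ₂ g₁ • magneticState K p g₁ g₂ := by
  refine diagonal_mulVec_magneticState hK p h₁ h₂ h₃ fun c hc => ?_
  obtain ⟨x, y⟩ := v
  set φ := potential c
  have hmul₁ : ∀ g h, χ₁ (g * h) = χ₁ g * χ₁ h := fun g h => by
    rw [hχ₁, hχ₁, hχ₁, hχ₂, hχ₃, mul_mul_mul_comm]
  have a := mul_prod_castSucc_lt (F := fun x => χ₁ (φ (x, y))) (g := fun x => χ₁ (c (.inl (x, y))))
    (fun x => by rw [← hmul₁, hc.1.1.potential_inl]) x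
  have b := mul_prod_le_castSucc (F := fun y => χ₂ (φ (x, y))) (g := fun y => χ₂ (c (.inr (x, y))))
    (fun y => by rw [← hχ₂, potential_inr]) y
  have d := mul_prod_le_castSucc (F := fun x => χ₃ (φ (x, y))) (g := fun x => χ₃ (c (.inl (x, y))))
    (fun x => by rw [← hχ₃, hc.1.1.potential_inl]) x
  rw [hK₁ _ (hc.1.potential_left_mem y), one_mul] at a
  rw [hK₃ _ (hc.1.potential_right_mem y)] at d
  have e := hc.1.potential_top_mem x
  rw [hc.2.1] at e
  have hb : χ₂ (φ (x, Fin.last n)) = χ₂ g₁ := by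
    rw [← mul_inv_cancel_left g₁ (φ (x, Fin.last n)), hχ₂, hK₂ _ e, mul_one]
  rw [hb] at b
  rw [a, hχ₁, ← b, mul_assoc, mul_assoc, mul_comm, mul_assoc, mul_assoc, mul_comm _ (χ₃ _), d,
    mul_one, mul_comm]

/-! ### The transversal gate as a diagonal operator -/

/-- The phase of `sptGate` on a basis state. -/
def sptFun (α : G → G → Circle) (β : Fin 3 → G → Circle) (c : Config G m n) : Circle :=
  (∏ p : Plaquette m n,
      α (c (leftEdge p)) (c (topEdge p)) / α (c (bottomEdge p)) (c (rightEdge p))) *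
    (∏ e ∈ boundaryEdges m n 0, β 0 (c e))⁻¹ * (∏ e ∈ boundaryEdges m n 1, β 1 (c e))⁻¹ *
    ∏ e ∈ boundaryEdges m n 2, β 2 (c e)

/-- The diagonal operator of a function with values in `U(1)`. -/
def phaseOp (f : Config G m n → Circle) : Op G m n := Matrix.diagonal fun c => (f c : ℂ)

theorem phaseOp_one : phaseOp (1 : Config G m n → Circle) = 1 := by
  simp [phaseOp]

theorem phaseOp_mul (f g : Config G m n → Circle) : phaseOp f * phaseOp g = phaseOp (f * g) := by
  simp [phaseOp]

theorem phaseOp_conjTranspose (f : Config G m n → Circle) : (phaseOp f)ᴴ = phaseOp f⁻¹ := by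
  rw [phaseOp, Matrix.diagonal_conjTranspose]
  congr 1
  funext c
  exact (Circle.coe_inv_eq_conj (f c)).symm

theorem phaseOp_mem_unitaryGroup (f : Config G m n → Circle) :
    phaseOp f ∈ Matrix.unitaryGroup (Config G m n) ℂ := by
  rw [Matrix.mem_unitaryGroup_iff, Matrix.star_eq_conjTranspose, phaseOp_conjTranspose,
    phaseOp_mul, mul_inv_cancel, phaseOp_one]

theorem noncommProd_phaseOp {ι : Type*} (S : Finset ι) (f : ι → Config G m n → Circle)
    (comm : (S : Set ι).Pairwise (Function.onFun Commute fun i => phaseOp (f i))) :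
    S.noncommProd (fun i => phaseOp (f i)) comm = phaseOp (∏ i ∈ S, f i) := by
  classical
  induction S using Finset.induction_on with
  | empty => simp [phaseOp_one]
  | insert a S ha ih =>
    rw [Finset.noncommProd_insert_of_notMem _ _ _ _ ha, ih, phaseOp_mul, Finset.prod_insert ha]

theorem edgeGateProd_eq (β : G → Circle) (S : Finset (Edge m n)) :
    edgeGateProd β S = phaseOp (∏ e ∈ S, fun c => β (c e)) :=
  noncommProd_phaseOp S (fun e c => β (c e)) _

theorem sptGate_eq (α : G → G → Circle) (β : Fin 3 → G → Circle) :
    sptGate m n α β = phaseOp (sptFun α β) := by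
  have h : Finset.univ.noncommProd (fun p : Plaquette m n => plaquetteGate α p)
      (fun _ _ _ _ _ => plaquetteGate_commute α _ _) = phaseOp (∏ p : Plaquette m n, fun c =>
        α (c (leftEdge p)) (c (topEdge p)) / α (c (bottomEdge p)) (c (rightEdge p))) :=
    noncommProd_phaseOp _ _ _
  rw [sptGate, h, edgeGateProd_eq, edgeGateProd_eq, edgeGateProd_eq, phaseOp_conjTranspose,
    phaseOp_conjTranspose, phaseOp_mul, phaseOp_mul, phaseOp_mul]
  congr 1
  funext c
  simp [sptFun]

theorem prod_boundaryEdges_zero {M : Type*} [CommMonoid M] (f : Edge m n → M) :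
    ∏ e ∈ boundaryEdges m n 0, f e = ∏ y, f (.inr (0, y)) := by
  have : boundaryEdges m n 0 = Finset.univ.image fun y => .inr (0, y) := by
    ext e
    simp [mem_boundaryEdges_zero, eq_comm]
  rw [this, Finset.prod_image]
  intro a _ b _ h
  simpa using h

theorem prod_boundaryEdges_one {M : Type*} [CommMonoid M] (f : Edge m n → M) :
    ∏ e ∈ boundaryEdges m n 1, f e = ∏ x, f (.inl (x, Fin.last n)) := by
  have : boundaryEdges m n 1 = Finset.univ.image fun x => .inl (x, Fin.last n) := by
    ext e
    simp [mem_boundaryEdges_one, eq_comm]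
  rw [this, Finset.prod_image]
  intro a _ b _ h
  simpa using h

theorem prod_boundaryEdges_two {M : Type*} [CommMonoid M] (f : Edge m n → M) :
    ∏ e ∈ boundaryEdges m n 2, f e =
      (∏ x, f (.inl (x, 0))) * ∏ y, f (.inr (Fin.last m, y)) := by
  have : boundaryEdges m n 2 = (Finset.univ.image fun x => .inl (x, 0)) ∪
      Finset.univ.image fun y => .inr (Fin.last m, y) := by
    ext e
    simp [mem_boundaryEdges_two, eq_comm]
  rw [this, Finset.prod_union, Finset.prod_image, Finset.prod_image]
  · intro a _ b _ h
    simpa using h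
  · intro a _ b _ h
    simpa using h
  · rw [Finset.disjoint_left]
    intro e he he'
    simp only [Finset.mem_image, Finset.mem_univ, true_and] at he he'
    obtain ⟨x, rfl⟩ := he
    obtain ⟨y, hy⟩ := he'
    cases hy

theorem prod_castSucc_div_succ {M : Type*} [CommGroup M] {k : ℕ} (f : Fin (k + 1) → M) :
    ∏ x : Fin k, f x.castSucc / f x.succ = f 0 / f (Fin.last k) := by
  have := mul_prod_univ (F := fun x => (f x)⁻¹) (g := fun x : Fin k => f x.castSucc / f x.succ)
    fun x => by simp [div_eq_mul_inv]
  rw [div_eq_mul_inv, ← this, mul_inv_cancel_left]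

/-- The discrete Stokes theorem: on a sector the phase of `sptGate` is `sptPhase`. -/
theorem sptFun_eq_sptPhase {K : Fin 3 → Subgroup G} {g₁ g₂ : G} {α : G → G → Circle}
    {β : Fin 3 → G → Circle} (hα : ∀ g h k, α g h * α (g * h) k = α g (h * k) * α h k)
    (hβ : ∀ i, ∀ g ∈ K i, ∀ h ∈ K i, α g h = coboundary (β i) g h) (hβ1 : ∀ i, β i 1 = 1)
    {c : Config G m n} (hc : c ∈ sector m n K g₁ g₂) :
    sptFun α β c = sptPhase α β g₁ g₂ := by
  set φ := potential c
  -- Normalization comes from `β 0 1 = 1`, which gives `α 1 1 = 1`, and the cocycle identity at `(g,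
  -- 1, 1)`.
  have hα1 : ∀ g, α g 1 = 1 := by
    intro g
    have h := hα g 1 1
    rw [mul_one, mul_one, hβ 0 1 (one_mem _) 1 (one_mem _)] at h
    simpa [coboundary, hβ1] using h
  -- `H` and `V` are the edge function `α (φ src) (c e)` on horizontal and vertical edges.
  let H : Fin m → Fin (n + 1) → Circle := fun x y => α (φ (x.castSucc, y)) (c (.inl (x, y)))
  let V : Fin (m + 1) → Fin n → Circle := fun x y => α (φ (x, y.castSucc)) (c (.inr (x, y)))
  have hloc : ∀ p : Plaquette m n,
      α (c (leftEdge p)) (c (topEdge p)) / α (c (bottomEdge p)) (c (rightEdge p)) =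
        (V p.1.castSucc p.2 / V p.1.succ p.2) * (H p.1 p.2.castSucc / H p.1 p.2.succ)⁻¹ := by
    rintro ⟨x, y⟩
    -- The identities for the paths left-top and bottom-right share the factor `α (φ v) (left *
    -- top)` by flatness; dividing them leaves the curl of `(H, V)` around the plaquette.
    have e1 := hα (φ (x.castSucc, y.castSucc)) (c (leftEdge (x, y))) (c (topEdge (x, y)))
    have e2 := hα (φ (x.castSucc, y.castSucc)) (c (bottomEdge (x, y))) (c (rightEdge (x, y)))
    have f1 : φ (x.castSucc, y.castSucc) * c (leftEdge (x, y)) = φ (x.castSucc, y.succ) :=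
      potential_inr c _ _
    have f2 : φ (x.castSucc, y.castSucc) * c (bottomEdge (x, y)) = φ (x.succ, y.castSucc) :=
      hc.1.1.potential_inl _ _
    rw [f1, hc.1.1 (x, y)] at e1
    rw [f2] at e2
    simp only [V, H]
    simp only [leftEdge, topEdge, bottomEdge, rightEdge] at e1 e2 ⊢
    rw [inv_div, div_mul_div_comm, e1, mul_comm (α (φ (x.succ, y.castSucc)) _), e2,
      mul_div_mul_left_eq_div]
  have hbulk : ∏ p : Plaquette m n,
      α (c (leftEdge p)) (c (topEdge p)) / α (c (bottomEdge p)) (c (rightEdge p)) =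
        ((∏ y, V 0 y) / ∏ y, V (Fin.last m) y) * ((∏ x, H x 0) / ∏ x, H x (Fin.last n))⁻¹ := by
    rw [Finset.prod_congr rfl fun p _ => hloc p, Finset.prod_mul_distrib, Finset.prod_inv_distrib]
    congr 1
    · rw [Fintype.prod_prod_type_right]
      rw [← Finset.prod_div_distrib]
      exact Finset.prod_congr rfl fun y _ => prod_castSucc_div_succ fun x => V x y
    · rw [Fintype.prod_prod_type]
      rw [← Finset.prod_div_distrib]
      exact congrArg _ (Finset.prod_congr rfl fun x _ => prod_castSucc_div_succ (H x))
  have hleft : (∏ y, V 0 y) / ∏ y, β 0 (c (.inr (0, y))) = (β 0 g₁)⁻¹ := by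
    have h := prod_castSucc_div_succ fun y => β 0 (φ (0, y))
    rw [show φ (0, 0) = 1 from potential_zero c, show φ (0, Fin.last n) = g₁ from hc.2.1,
      hβ1, one_div] at h
    rw [← Finset.prod_div_distrib, ← h]
    refine Finset.prod_congr rfl fun y _ => ?_
    simp only [V]
    rw [hβ 0 _ (hc.1.potential_left_mem _) _ (hc.1.2 0 _ (mem_boundaryEdges_zero.2 ⟨_, rfl⟩)),
      coboundary, potential_inr, div_right_comm, mul_div_cancel_right]
  have htop : (∏ x, H x (Fin.last n)) / ∏ x, β 1 (c (.inl (x, Fin.last n))) =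
      α g₁ g₂ / β 1 g₂ := by
    -- On the top side `φ = g₁ t` with `t` in `K 1`. The cocycle identity at `(g₁, t, c e)` makes
    -- the quotient of `H` by `β 1` the increment of `α g₁ t / β 1 t`; its value at the right end is
    -- the source of `α g₁ g₂`.
    let t : Fin (m + 1) → G := fun x => g₁⁻¹ * φ (x, Fin.last n)
    have ht : ∀ x, t x ∈ K 1 := fun x => by
      have := hc.1.potential_top_mem x
      rwa [hc.2.1] at this
    have h := prod_castSucc_div_succ fun x => β 1 (t x) / α g₁ (t x)
    have t0 : t 0 = 1 := by
      simp only [t]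
      rw [show φ (0, Fin.last n) = g₁ from hc.2.1, inv_mul_cancel]
    have t1 : t (Fin.last m) = g₂ := by
      simp only [t]
      rw [show φ (Fin.last m, Fin.last n) = g₁ * g₂ from hc.2.2, inv_mul_cancel_left]
    rw [t0, t1, hβ1, hα1, div_one, one_div, inv_div] at h
    rw [← Finset.prod_div_distrib, ← h]
    refine Finset.prod_congr rfl fun x _ => ?_
    have e := hα g₁ (t x.castSucc) (c (.inl (x, Fin.last n)))
    have ht' : t x.castSucc * c (.inl (x, Fin.last n)) = t x.succ := by
      simp only [t]
      rw [mul_assoc, hc.1.1.potential_inl]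
    rw [hβ 1 (t _) (ht _) _ (hc.1.2 1 _ (mem_boundaryEdges_one.2 ⟨_, rfl⟩)), coboundary, ht',
      show g₁ * t x.castSucc = φ (x.castSucc, Fin.last n) from mul_inv_cancel_left _ _] at e
    simp only [H]
    have e' := congrArg (fun z : Circle => (z : ℂ)) e
    ext
    push_cast at e' ⊢
    field_simp at e' ⊢
    linear_combination e'
  -- The bottom and right sides form one path from `φ = 1` to `φ = g₁ * g₂` inside `K 2`; the values
  -- at the lower right vertex cancel.
  have hright : (∏ e ∈ boundaryEdges m n 2, β 2 (c e)) =
      ((∏ x, H x 0) * ∏ y, V (Fin.last m) y) * β 2 (g₁ * g₂) := by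
    have hx := prod_castSucc_div_succ fun x => β 2 (φ (x, 0))
    have hy := prod_castSucc_div_succ fun y => β 2 (φ (Fin.last m, y))
    rw [show φ (0, 0) = 1 from potential_zero c, hβ1] at hx
    rw [show φ (Fin.last m, Fin.last n) = g₁ * g₂ from hc.2.2] at hy
    have ex : ∀ x, H x 0 = β 2 (c (.inl (x, 0))) *
        (β 2 (φ (x.castSucc, 0)) / β 2 (φ (x.succ, 0))) := fun x => by
      simp only [H]
      rw [hβ 2 _ (hc.1.potential_bottom_mem _) _
        (hc.1.2 2 _ (mem_boundaryEdges_two.2 (.inl ⟨_, rfl⟩))), coboundary, hc.1.1.potential_inl,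
        mul_div_right_comm, mul_comm]
    have ey : ∀ y, V (Fin.last m) y = β 2 (c (.inr (Fin.last m, y))) *
        (β 2 (φ (Fin.last m, y.castSucc)) / β 2 (φ (Fin.last m, y.succ))) := fun y => by
      simp only [V]
      rw [hβ 2 _ (hc.1.potential_right_mem _) _
        (hc.1.2 2 _ (mem_boundaryEdges_two.2 (.inr ⟨_, rfl⟩))), coboundary, potential_inr,
        mul_div_right_comm, mul_comm]
    rw [prod_boundaryEdges_two, Finset.prod_congr rfl fun x _ => ex x,
      Finset.prod_congr rfl fun y _ => ey y, Finset.prod_mul_distrib, Finset.prod_mul_distrib,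
      hx, hy]
    ext
    push_cast
    field_simp
  rw [sptFun, hbulk, prod_boundaryEdges_zero, prod_boundaryEdges_one, hright, sptPhase]
  rw [div_eq_iff_eq_mul] at hleft htop
  rw [hleft, htop]
  ext
  push_cast
  field_simp

/-! ### The transversal gate as a local circuit -/

section Circuit

theorem actsOn_phaseOp {S : Finset (Edge m n)} {f : Config G m n → Circle}
    (h : ∀ c c' : Config G m n, (∀ e ∈ S, c e = c' e) → f c = f c') : ActsOn S (phaseOp f) := by
  classical
  -- The labels on `S` are extended by `1`; `f` does not see the choice outside `S`.
  refine ⟨fun a b => if a = b then (f fun e => if he : e ∈ S then a ⟨e, he⟩ else 1) else 0, ?_⟩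
  intro c' c
  by_cases hcc : c' = c
  · subst hcc
    simp only [phaseOp, Matrix.diagonal_apply_eq, implies_true, if_true]
    rw [h c' (fun e => if he : e ∈ S then c' e else 1)]
    intro e he
    simp [he]
  · rw [phaseOp, Matrix.diagonal_apply_ne _ hcc]
    split_ifs with hout
    · refine (if_neg fun hin => hcc (funext fun e => ?_)).symm
      by_cases he : e ∈ S
      · exact congrFun hin ⟨e, he⟩
      · exact hout e he
    · rfl

/-- A layer of diagonal gates. -/
def phaseLayer {ι : Type} (S : Finset ι) (supp : ι → Finset (Edge m n))
    (f : ι → Config G m n → Circle) : List (Finset (Edge m n) × Op G m n) :=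
  S.toList.map fun i => (supp i, phaseOp (f i))

theorem prod_phaseLayer {ι : Type} (S : Finset ι) (supp : ι → Finset (Edge m n))
    (f : ι → Config G m n → Circle) :
    ((phaseLayer S supp f).map Prod.snd).prod = phaseOp (∏ i ∈ S, f i) := by
  have : ∀ l : List ι, (l.map fun i => phaseOp (f i)).prod = phaseOp (l.map f).prod := by
    intro l
    induction l with
    | nil => simp [phaseOp_one]
    | cons a l ih => rw [List.map_cons, List.prod_cons, ih, List.map_cons, List.prod_cons,
        phaseOp_mul]
  rw [phaseLayer, List.map_map, ← Finset.prod_map_toList, ← this]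
  rfl

theorem isLocalLayer_phaseLayer {ι : Type} {S : Finset ι} {supp : ι → Finset (Edge m n)}
    {f : ι → Config G m n → Circle} (hdisj : ∀ i ∈ S, ∀ j ∈ S, i ≠ j → Disjoint (supp i) (supp j))
    (hloc : ∀ i ∈ S, ∃ p, supp i ⊆ plaquetteEdges p)
    (hf : ∀ i, ∀ c c' : Config G m n, (∀ e ∈ supp i, c e = c' e) → f i c = f i c') :
    IsLocalLayer (phaseLayer S supp f) := by
  constructor
  · rw [phaseLayer, List.pairwise_map]
    refine S.nodup_toList.pairwise_of_forall_ne fun i hi j hj hij => ?_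
    exact hdisj i (Finset.mem_toList.1 hi) j (Finset.mem_toList.1 hj) hij
  · intro a ha
    obtain ⟨i, hi, rfl⟩ := List.mem_map.1 ha
    exact ⟨hloc i (Finset.mem_toList.1 hi), actsOn_phaseOp (hf i), phaseOp_mem_unitaryGroup _⟩

theorem exists_mem_plaquetteEdges [NeZero m] [NeZero n] (e : Edge m n) :
    ∃ p, e ∈ plaquetteEdges p := by
  rcases e with ⟨x, y⟩ | ⟨x, y⟩
  · obtain ⟨j, rfl | rfl⟩ := exists_succ_or_castSucc y
    · exact ⟨(x, j), by simp [plaquetteEdges, bottomEdge]⟩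
    · exact ⟨(x, j), by simp [plaquetteEdges, topEdge]⟩
  · obtain ⟨j, rfl | rfl⟩ := exists_succ_or_castSucc x
    · exact ⟨(j, y), by simp [plaquetteEdges, leftEdge]⟩
    · exact ⟨(j, y), by simp [plaquetteEdges, rightEdge]⟩

/-- Distinct plaquettes sharing an edge are neighbours, hence of opposite colour on the
checkerboard. -/
theorem disjoint_plaquetteEdges {p q : Plaquette m n} (hpq : p ≠ q)
    (h : (p.1.val + p.2.val) % 2 = (q.1.val + q.2.val) % 2) :
    Disjoint (plaquetteEdges p) (plaquetteEdges q) := by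
  obtain ⟨p1, p2⟩ := p
  obtain ⟨q1, q2⟩ := q
  have hne : ¬ (p1.val = q1.val ∧ p2.val = q2.val) := fun h' =>
    hpq (Prod.ext (Fin.ext h'.1) (Fin.ext h'.2))
  rw [Finset.disjoint_left]
  intro e he he'
  simp only [plaquetteEdges, leftEdge, topEdge, rightEdge, bottomEdge, Finset.mem_insert,
    Finset.mem_singleton] at he he' h
  rcases he with rfl | rfl | rfl | rfl <;>
    simp only [Sum.inl.injEq, Sum.inr.injEq, Prod.mk.injEq, reduceCtorEq, false_or, or_false,
      Fin.ext_iff, Fin.val_castSucc, Fin.val_succ] at he' <;> omega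

theorem isLocalLayer_edges [NeZero m] [NeZero n] (β : G → Circle) (S : Finset (Edge m n)) :
    IsLocalLayer (phaseLayer S (fun e => {e}) fun e (c : Config G m n) => β (c e)) := by
  refine isLocalLayer_phaseLayer (fun i _ j _ hij => by simpa using hij) (fun e _ => ?_)
    fun e c c' h => by rw [h e (Finset.mem_singleton_self e)]
  obtain ⟨p, hp⟩ := exists_mem_plaquetteEdges e
  exact ⟨p, Finset.singleton_subset_iff.2 hp⟩

/-- Two layers for the checkerboard colours of the plaquettes and one layer for each of the three
sides. -/
theorem isLocalCircuit_sptGate [NeZero m] [NeZero n] (α : G → G → Circle)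
    (β : Fin 3 → G → Circle) : IsLocalCircuit 5 (sptGate m n α β) := by
  let f : Plaquette m n → Config G m n → Circle := fun p c =>
    α (c (leftEdge p)) (c (topEdge p)) / α (c (bottomEdge p)) (c (rightEdge p))
  let even : Plaquette m n → Prop := fun p => (p.1.val + p.2.val) % 2 = 0
  have hf : ∀ p, ∀ c c' : Config G m n, (∀ e ∈ plaquetteEdges p, c e = c' e) → f p c = f p c' := by
    intro p c c' h
    simp only [f]
    rw [h (leftEdge p) (by simp [plaquetteEdges]), h (topEdge p) (by simp [plaquetteEdges]),
      h (rightEdge p) (by simp [plaquetteEdges]), h (bottomEdge p) (by simp [plaquetteEdges])]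
  refine ⟨[phaseLayer (Finset.univ.filter fun p => even p) plaquetteEdges f,
    phaseLayer (Finset.univ.filter fun p => ¬ even p) plaquetteEdges f,
    phaseLayer (boundaryEdges m n 0) (fun e => {e}) fun e c => (β 0 (c e))⁻¹,
    phaseLayer (boundaryEdges m n 1) (fun e => {e}) fun e c => (β 1 (c e))⁻¹,
    phaseLayer (boundaryEdges m n 2) (fun e => {e}) fun e c => β 2 (c e)], le_rfl, ?_, ?_⟩
  · simp only [List.forall_mem_cons, List.not_mem_nil, IsEmpty.forall_iff, implies_true, and_true]
    refine ⟨?_, ?_, isLocalLayer_edges (fun g => (β 0 g)⁻¹) _,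
      isLocalLayer_edges (fun g => (β 1 g)⁻¹) _, isLocalLayer_edges (β 2) _⟩
    · refine isLocalLayer_phaseLayer (fun p hp q hq hpq => disjoint_plaquetteEdges hpq ?_)
        (fun p _ => ⟨p, subset_rfl⟩) hf
      simp only [Finset.mem_filter, Finset.mem_univ, true_and, even] at hp hq
      omega
    · refine isLocalLayer_phaseLayer (fun p hp q hq hpq => disjoint_plaquetteEdges hpq ?_)
        (fun p _ => ⟨p, subset_rfl⟩) hf
      simp only [Finset.mem_filter, Finset.mem_univ, true_and, even] at hp hq
      omega
  · simp only [List.map_cons, List.map_nil, List.prod_cons, List.prod_nil, mul_one,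
      prod_phaseLayer, phaseOp_mul]
    rw [sptGate_eq]
    congr 1
    rw [← mul_assoc, Finset.prod_filter_mul_prod_filter_not]
    funext c
    simp [sptFun, f, mul_assoc]

end Circuit

end QuantumDouble

end

noncomputable section

/-! ### Central extensions by `U(1)` -/

/-- The multiplicative 2-cocycle condition for the trivial action. -/
def IsU1Cocycle {G : Type} [Group G] (α : G → G → Circle) : Prop :=
  ∀ g h k, α g h * α (g * h) k = α g (h * k) * α h k

section Cohomology

variable {G : Type} [Group G]

theorem toCochain_mem_cocycles₂ {α : G → G → Circle} :
    toCochain α ∈ groupCohomology.cocycles₂ (u1Rep G) ↔ IsU1Cocycle α := by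
  rw [groupCohomology.mem_cocycles₂_iff]
  refine forall_congr' fun g => forall_congr' fun h => forall_congr' fun k => ?_
  constructor
  · intro e
    have e' : α (g * h) k * α g h = α h k * α g (h * k) := e
    rw [mul_comm, e', mul_comm]
  · intro e
    change Additive.ofMul (α (g * h) k * α g h) = Additive.ofMul (α h k * α g (h * k))
    rw [mul_comm, e, mul_comm]

theorem toCochain_mem_coboundaries₂ {α : G → G → Circle} :
    toCochain α ∈ groupCohomology.coboundaries₂ (u1Rep G) ↔ ∃ κ, ∀ g h, α g h = coboundary κ g h := by
  constructor
  · rintro ⟨κ, hκ⟩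
    let κ' : G → Circle := fun g => Additive.toMul (show Additive Circle from κ g)
    refine ⟨κ', fun g h => ?_⟩
    have e : κ' h / κ' (g * h) * κ' g = α g h := congrFun hκ (g, h)
    rw [← e, coboundary, div_mul_eq_mul_div, mul_comm]
  · rintro ⟨κ, hκ⟩
    refine ⟨fun g => Additive.ofMul (κ g), funext fun ⟨g, h⟩ => ?_⟩
    change Additive.ofMul (κ h / κ (g * h) * κ g) = Additive.ofMul (α g h)
    rw [hκ, coboundary, div_mul_eq_mul_div, mul_comm]

theorem isU1Cocycle_coboundary (κ : G → Circle) : IsU1Cocycle (coboundary κ) := by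
  intro g h k
  simp only [coboundary, mul_assoc]
  ext
  push_cast
  field_simp

theorem IsU1Cocycle.mul {α α' : G → G → Circle} (h : IsU1Cocycle α) (h' : IsU1Cocycle α') :
    IsU1Cocycle fun g k => α g k * α' g k := fun g k l => by
  rw [mul_mul_mul_comm, h, h', mul_mul_mul_comm]

theorem IsU1Cocycle.one_left {α : G → G → Circle} (h : IsU1Cocycle α) (g : G) :
    α 1 g = α 1 1 := by
  simpa using (h 1 1 g).symm

theorem IsU1Cocycle.one_right {α : G → G → Circle} (h : IsU1Cocycle α) (g : G) :
    α g 1 = α 1 1 := by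
  simpa using h g 1 1

/-- The underlying set of the central extension of `G` by `U(1)` defined by a 2-cocycle. -/
@[ext]
structure CentralExt {α : G → G → Circle} (hα : IsU1Cocycle α) where
  /-- The coordinate in the fibre. -/
  fib : Circle
  /-- The projection to the base. -/
  base : G

namespace CentralExt

variable {α : G → G → Circle} {hα : IsU1Cocycle α}

instance : Mul (CentralExt hα) := ⟨fun x y => ⟨x.fib * y.fib * α x.base y.base, x.base * y.base⟩⟩
-- The cocycle is not assumed normalized; the factors `α 1 1` in the unit, the inverse and
-- `ofCircle` compensate for this.
instance : One (CentralExt hα) := ⟨⟨(α 1 1)⁻¹, 1⟩⟩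
instance : Inv (CentralExt hα) := ⟨fun x => ⟨(x.fib * α x.base⁻¹ x.base * α 1 1)⁻¹, x.base⁻¹⟩⟩

@[simp] theorem fib_mul (x y : CentralExt hα) :
    (x * y).fib = x.fib * y.fib * α x.base y.base := rfl
@[simp] theorem base_mul (x y : CentralExt hα) : (x * y).base = x.base * y.base := rfl
@[simp] theorem fib_one : (1 : CentralExt hα).fib = (α 1 1)⁻¹ := rfl
@[simp] theorem base_one : (1 : CentralExt hα).base = 1 := rfl
@[simp] theorem fib_inv (x : CentralExt hα) :
    x⁻¹.fib = (x.fib * α x.base⁻¹ x.base * α 1 1)⁻¹ := rfl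
@[simp] theorem base_inv (x : CentralExt hα) : x⁻¹.base = x.base⁻¹ := rfl

instance : Group (CentralExt hα) :=
  Group.ofLeftAxioms
    (fun x y z => by
      ext1
      · have := hα x.base y.base z.base
        simp only [fib_mul, base_mul]
        calc _ = x.fib * y.fib * z.fib * (α x.base y.base * α (x.base * y.base) z.base) := by
              simp only [mul_left_comm, mul_comm]
          _ = _ := by
              rw [this]
              simp only [mul_left_comm, mul_comm]
      · exact mul_assoc _ _ _)
    (fun x => by
      ext1
      · simp [hα.one_left, mul_comm, mul_left_comm]
      · simp)
    (fun x => by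
      ext1
      · simp only [fib_mul, fib_inv, base_inv, fib_one]
        ext
        push_cast
        field_simp
      · simp)

/-- The projection to the base. -/
def toBase (hα : IsU1Cocycle α) : CentralExt hα →* G where
  toFun := base
  map_one' := rfl
  map_mul' _ _ := rfl

/-- The inclusion of the fibre over `1`. -/
def ofCircle (hα : IsU1Cocycle α) : Circle →* CentralExt hα where
  toFun z := ⟨z * (α 1 1)⁻¹, 1⟩
  map_one' := by
    ext1
    · simp
    · rfl
  map_mul' a b := by
    ext1
    · simp [mul_comm, mul_left_comm, mul_assoc]
    · simp

theorem fib_ofCircle_mul (z : Circle) (x : CentralExt hα) :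
    (ofCircle hα z * x).fib = z * x.fib := by
  simp [ofCircle, hα.one_left, mul_comm, mul_left_comm]

theorem base_ofCircle_mul (z : Circle) (x : CentralExt hα) :
    (ofCircle hα z * x).base = x.base := by
  simp [ofCircle]

theorem ofCircle_mul_comm (z : Circle) (x : CentralExt hα) :
    ofCircle hα z * x = x * ofCircle hα z := by
  ext1
  · simp [ofCircle, hα.one_left, hα.one_right, mul_comm]
  · simp [ofCircle]

theorem ofCircle_injective : Function.Injective (ofCircle hα) := by
  intro a b h
  have := congrArg fib h
  simpa [ofCircle] using this

theorem exists_ofCircle_mul_eq {x y : CentralExt hα} (h : x.base = y.base) :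
    ∃ z, ofCircle hα z * x = y := by
  refine ⟨y.fib / x.fib, ?_⟩
  ext1
  · rw [fib_ofCircle_mul, div_mul_cancel]
  · rw [base_ofCircle_mul, h]

theorem exists_ofCircle_eq {x : CentralExt hα} (h : x.base = 1) : ∃ z, ofCircle hα z = x := by
  obtain ⟨z, hz⟩ := exists_ofCircle_mul_eq (x := 1) (y := x) h.symm
  exact ⟨z, by rwa [mul_one] at hz⟩

theorem ofCircle_mul_pow (z : Circle) (x : CentralExt hα) (k : ℕ) :
    (ofCircle hα z * x) ^ k = ofCircle hα (z ^ k) * x ^ k := by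
  rw [Commute.mul_pow (ofCircle_mul_comm z x), map_pow]

/-- Multiplicativity of a section writes `α` as the failure of its fibre coordinate to be
multiplicative, with the roles inverted; hence the inverse in the witness. -/
theorem exists_coboundary_of_section (s : G →* CentralExt hα) (hs : ∀ g, (s g).base = g) :
    ∃ κ, ∀ g h, α g h = coboundary κ g h := by
  refine ⟨fun g => (s g).fib⁻¹, fun g h => ?_⟩
  have e := congrArg fib (s.map_mul g h)
  rw [fib_mul, hs, hs] at e
  rw [coboundary, e]
  simp [mul_comm]

theorem mul_eq_ofCircle_mul {x y : CentralExt hα} (h : x.base * y.base = y.base * x.base) :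
    x * y = ofCircle hα (α x.base y.base / α y.base x.base) * (y * x) := by
  ext1
  · rw [fib_ofCircle_mul, fib_mul, fib_mul, div_mul_eq_mul_div, eq_div_iff_mul_eq']
    simp only [mul_comm, mul_left_comm]
  · rw [base_ofCircle_mul, base_mul, base_mul, h]

end CentralExt

/-- The quotient is the commutator of lifts `Z`, `S`. Moving `Z` past `S` twice squares it, while `S
* S` lies over `1` and is central. -/
theorem IsU1Cocycle.div_sq_of_commute {α : G → G → Circle} (hα : IsU1Cocycle α) {z s : G}
    (hs : s * s = 1) (hzs : z * s = s * z) : (α z s / α s z) ^ 2 = 1 := by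
  open CentralExt in
  let Z : CentralExt hα := ⟨1, z⟩
  let S : CentralExt hα := ⟨1, s⟩
  have h : Z * S = ofCircle hα (α z s / α s z) * (S * Z) := mul_eq_ofCircle_mul hzs
  obtain ⟨w, hw⟩ := exists_ofCircle_eq (x := S * S) hs
  apply ofCircle_injective (hα := hα)
  have e : Z * (S * S) = ofCircle hα ((α z s / α s z) ^ 2) * ((S * S) * Z) := by
    rw [← mul_assoc, h, mul_assoc, mul_assoc, h, pow_two, map_mul, ← mul_assoc S,
      ← ofCircle_mul_comm]
    simp only [mul_assoc]
  rw [← hw, ← ofCircle_mul_comm, right_eq_mul] at e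
  rw [e, map_one]

end Cohomology

theorem Circle.exists_pow_eq (z : Circle) {k : ℕ} (hk : k ≠ 0) : ∃ w : Circle, w ^ k = z := by
  refine ⟨Circle.exp (Complex.arg z / k), ?_⟩
  rw [← Circle.exp_nsmul, nsmul_eq_mul, mul_div_cancel₀ _ (Nat.cast_ne_zero.2 hk), Circle.exp_arg]

/-! ### Homomorphisms out of dihedral groups -/

/-- The universal property of the dihedral presentation: the last relation says that `S` inverts `R`
by conjugation, which gives the multiplication rules for reflections. -/
theorem DihedralGroup.exists_hom {E : Type*} [Group E] {k : ℕ} {R S : E} (hR : R ^ k = 1)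
    (hS : S * S = 1) (hSR : S * R * S * R = 1) :
    ∃ f : DihedralGroup k →* E, f (.r 1) = R ∧ f (.sr 0) = S := by
  let ρ : ZMod k →+ Additive E := ZMod.lift k ⟨zmultiplesHom _ (Additive.ofMul R), by
    simp only [zmultiplesHom_apply, natCast_zsmul]
    exact hR⟩
  let φ : ZMod k → E := fun i => Additive.toMul (ρ i)
  have hφ : ∀ i j, φ (i + j) = φ i * φ j := fun i j => by
    simp only [φ, map_add, toMul_add]
  have hφi : ∀ j : ℤ, φ j = R ^ j := fun j => by
    simp [φ, ρ]
  have hφ0 : φ 0 = 1 := by simpa using hφi 0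
  have hφS : ∀ i, φ i * S = S * φ (-i) := by
    intro i
    obtain ⟨j, rfl⟩ := ZMod.intCast_surjective i
    rw [← Int.cast_neg, hφi, hφi]
    have hconj : S * R * S⁻¹ = R⁻¹ := by
      rw [inv_eq_of_mul_eq_one_right hS, eq_inv_iff_mul_eq_one, hSR]
    have : S * R ^ j * S⁻¹ = R ^ (-j) := by
      rw [← conj_zpow, hconj, inv_zpow, zpow_neg]
    have h2 : S * R ^ (-j) * S⁻¹ = R ^ j := by
      rw [← conj_zpow, hconj, inv_zpow, zpow_neg, inv_inv]
    rw [← h2, inv_mul_cancel_right]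
  refine ⟨⟨⟨fun | .r i => φ i | .sr i => S * φ i, hφ0⟩, ?_⟩, ?_, ?_⟩
  · rintro (i | i) (j | j)
    · exact hφ i j
    · change S * φ (j - i) = φ i * (S * φ j)
      rw [← mul_assoc, hφS, mul_assoc, ← hφ, neg_add_eq_sub]
    · change S * φ (i + j) = S * φ i * φ j
      rw [hφ, mul_assoc]
    · change φ (j - i) = S * φ i * (S * φ j)
      rw [mul_assoc, ← mul_assoc (φ i), hφS, ← mul_assoc, ← mul_assoc, hS, one_mul, ← hφ,
        neg_add_eq_sub]
  · change φ 1 = R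
    simpa using hφi 1
  · change S * φ 0 = S
    rw [hφ0, mul_one]

/-- A 2-cocycle of a dihedral group of order `4k` is a coboundary as soon as it is symmetric on the
central rotation and a reflection. -/
theorem DihedralGroup.exists_coboundary {k : ℕ} (hk : k ≠ 0)
    {α : DihedralGroup (2 * k) → DihedralGroup (2 * k) → Circle} (hα : IsU1Cocycle α)
    (h : α (.r k) (.sr 0) = α (.sr 0) (.r k)) : ∃ κ, ∀ g h, α g h = coboundary κ g h := by
  open CentralExt in
  have hbase : ∀ (x : CentralExt hα) (j : ℕ), (x ^ j).base = x.base ^ j :=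
    fun x j => map_pow (toBase hα) x j
  have hn : 2 * k ≠ 0 := by omega
  -- Divisibility of the circle lets any lift be rescaled so that its power over `1` becomes
  -- trivial; the same is done for `S`.
  obtain ⟨R₁, hR₁, hR₁n⟩ : ∃ R : CentralExt hα, R.base = .r 1 ∧ R ^ (2 * k) = 1 := by
    let R₀ : CentralExt hα := ⟨1, .r 1⟩
    obtain ⟨z, hz⟩ := exists_ofCircle_eq (x := R₀ ^ (2 * k)) (by
      rw [hbase]
      exact DihedralGroup.r_one_pow_n)
    obtain ⟨w, hw⟩ := Circle.exists_pow_eq z⁻¹ hn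
    refine ⟨ofCircle hα w * R₀, base_ofCircle_mul _ _, ?_⟩
    rw [ofCircle_mul_pow, hw, ← hz, ← map_mul, inv_mul_cancel, map_one]
  obtain ⟨S, hS, hSS⟩ : ∃ S : CentralExt hα, S.base = .sr 0 ∧ S ^ 2 = 1 := by
    let S₀ : CentralExt hα := ⟨1, .sr 0⟩
    obtain ⟨z, hz⟩ := exists_ofCircle_eq (x := S₀ ^ 2) (by
      rw [hbase, pow_two]
      exact DihedralGroup.sr_mul_self 0)
    obtain ⟨w, hw⟩ := Circle.exists_pow_eq z⁻¹ two_ne_zero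
    refine ⟨ofCircle hα w * S₀, base_ofCircle_mul _ _, ?_⟩
    rw [ofCircle_mul_pow, hw, ← hz, ← map_mul, inv_mul_cancel, map_one]
  rw [pow_two] at hSS
  have hSinv : S⁻¹ = S := inv_eq_of_mul_eq_one_right hSS
  obtain ⟨c, hc⟩ := exists_ofCircle_eq (x := S * R₁ * S * R₁) (by
    simp [hS, hR₁])
  -- `R₁ ^ k` lies over the central rotation, and its commutator with `S` is the quotient that `h`
  -- makes trivial.
  have hcomm : R₁ ^ k * S = S * R₁ ^ k := by
    have hb : (R₁ ^ k).base = .r k := by rw [hbase, hR₁, DihedralGroup.r_one_pow]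
    have hk2 : -(k : ZMod (2 * k)) = k := by
      rw [neg_eq_iff_add_eq_zero, ← two_mul]
      exact_mod_cast ZMod.natCast_self (2 * k)
    have := mul_eq_ofCircle_mul (x := R₁ ^ k) (y := S) (by
      rw [hb, hS, DihedralGroup.r_mul_sr, DihedralGroup.sr_mul_r, zero_sub, zero_add, hk2])
    rwa [hb, hS, h, div_self', map_one, one_mul] at this
  -- Conjugation by `S` sends `R₁` to `c R₁⁻¹`, so it sends `R₁ ^ k` to `c ^ k` times itself, as `R₁
  -- ^ (2 * k) = 1`; but it fixes `R₁ ^ k`.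
  have hck : c ^ k = 1 := by
    have e1 : S * R₁ * S⁻¹ = ofCircle hα c * R₁⁻¹ := by
      rw [hSinv, hc, mul_inv_cancel_right]
    have e2 : S * R₁ ^ k * S⁻¹ = ofCircle hα (c ^ k) * (R₁ ^ k)⁻¹ := by
      rw [← conj_pow, e1, ofCircle_mul_pow, inv_pow]
    have e3 : (R₁ ^ k)⁻¹ = R₁ ^ k := by
      apply inv_eq_of_mul_eq_one_right
      rw [← pow_add, ← two_mul, hR₁n]
    rw [← hcomm, mul_inv_cancel_right, e3, right_eq_mul] at e2
    apply ofCircle_injective (hα := hα)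
    rw [e2, map_one]
  -- Rescaling `R₁` by `d` multiplies `S R₁ S R₁` by `d ^ 2 = c⁻¹`, and keeps `R₁ ^ (2 * k) = 1`
  -- because `d ^ (2 * k) = (c ^ k)⁻¹ = 1`.
  obtain ⟨d, hd⟩ := Circle.exists_pow_eq c⁻¹ two_ne_zero
  obtain ⟨f, hfr, hfs⟩ := DihedralGroup.exists_hom (k := 2 * k) (R := ofCircle hα d * R₁) (S := S)
    (by rw [ofCircle_mul_pow, hR₁n, pow_mul, hd, inv_pow, hck, inv_one, map_one, one_mul]) hSS (by
      calc S * (ofCircle hα d * R₁) * S * (ofCircle hα d * R₁)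
          = ofCircle hα d * (S * R₁ * S) * (ofCircle hα d * R₁) := by
            rw [← mul_assoc S, ← ofCircle_mul_comm]
            simp only [mul_assoc]
        _ = ofCircle hα d * (ofCircle hα d * (S * R₁ * S * R₁)) := by
            rw [mul_assoc (ofCircle hα d), ← mul_assoc (S * R₁ * S), ← ofCircle_mul_comm]
            simp only [mul_assoc]
        _ = 1 := by
            rw [← hc, ← map_mul, ← map_mul, ← mul_assoc, ← pow_two, hd, inv_mul_cancel, map_one])
  refine exists_coboundary_of_section f ?_
  have hr : ∀ i, (f (.r i)).base = .r i := by
    intro i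
    obtain ⟨j, rfl⟩ := ZMod.intCast_surjective i
    rw [← DihedralGroup.r_one_zpow, map_zpow, hfr]
    refine (map_zpow (toBase hα) _ j).trans ?_
    congr 1
    exact (base_ofCircle_mul _ _).trans hR₁
  rintro (i | i)
  · exact hr i
  · rw [show (DihedralGroup.sr i : DihedralGroup (2 * k)) = .sr 0 * .r i by simp, map_mul, base_mul,
      hfs, hS, hr]

end

noncomputable section

set_option linter.unusedSectionVars false

/-! ### The dihedral data: cocycle, boundaries, characters and cohomology -/

namespace Dihedral4N

variable {N : ℕ} [NeZero N]

theorem one_lt_four_mul : 1 < 4 * N := by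
  have := NeZero.pos N
  omega

/-! ### Exponents and lifts -/

theorem rotExp_lt (g : D N) : rotExp g < 4 * N := by
  rcases g with i | i <;> exact ZMod.val_lt _

theorem val_one_zmod : (1 : ZMod (4 * N)).val = 1 := by
  have : Fact (1 < 4 * N) := ⟨one_lt_four_mul⟩
  exact ZMod.val_one _

theorem rs_eq : r N * s N = .sr (-1) := by
  simp [r, s]

@[simp] theorem rotExp_one : rotExp (1 : D N) = 0 := by
  rw [DihedralGroup.one_def]
  simp [rotExp]

@[simp] theorem reflExp_one : reflExp (1 : D N) = 0 := rfl

@[simp] theorem rotExp_rs : rotExp (r N * s N) = 1 := by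
  rw [rs_eq]
  simp only [rotExp, neg_neg]
  exact val_one_zmod

@[simp] theorem reflExp_rs : reflExp (r N * s N) = 1 := by
  rw [rs_eq, reflExp]

@[simp] theorem rotExp_s : rotExp (s N) = 0 := by
  simp [s, rotExp]

@[simp] theorem reflExp_s : reflExp (s N) = 1 := rfl

@[simp] theorem rotExp_r : rotExp (r N) = 1 := val_one_zmod

/-- The exponent `a + (1 - 2j) b` of the product of `r^a s^j` and `r^b s^k`, before reduction. -/
def mulExp (g h : D N) : ℤ := (rotExp g : ℤ) + (1 - 2 * reflExp g) * rotExp h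

theorem dvd_mulExp_sub (g h : D N) : ((4 * N : ℕ) : ℤ) ∣ mulExp g h - rotExp (g * h) := by
  rw [← ZMod.intCast_zmod_eq_zero_iff_dvd]
  rcases g with i | i <;> rcases h with j | j <;>
    simp [mulExp, rotExp, reflExp] <;> ring

theorem lift_mul_lift (g h : D N) : lift N g * lift N h =
    .r ((mulExp g h - rotExp (g * h) : ℤ) : ZMod (8 * N)) * lift N (g * h) := by
  rcases g with i | i <;> rcases h with j | j <;>
    simp [lift, mulExp, rotExp, reflExp] <;> ring

/-- The unreduced exponent exceeds the reduced one by `4N q`. Modulo `8N` only the parity of `q`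
survives, and it decides in which half of `[0, 8N)` the residue falls. -/
theorem alpha'_eq (g h : D N) :
    alpha' N g h = if ((8 * N : ℕ) : ℤ) ∣ mulExp g h - rotExp (g * h) then 1 else -1 := by
  have hN := NeZero.pos N
  obtain ⟨q, hq⟩ := dvd_mulExp_sub g h
  have hlt : (rotExp (g * h) : ℤ) < 4 * N := by exact_mod_cast rotExp_lt (g * h)
  have hpos : (0 : ℤ) ≤ rotExp (g * h) := Int.natCast_nonneg _
  have e : alpha' N g h = if (4 * N : ℤ) ≤ mulExp g h % (8 * N) then -1 else 1 := rfl
  rw [e]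
  push_cast at hq ⊢
  obtain ⟨t, rfl | rfl⟩ := Int.even_or_odd' q
  · have h1 : mulExp g h = rotExp (g * h) + 8 * N * t := by linear_combination hq
    have h2 : mulExp g h % (8 * N) = rotExp (g * h) := by
      rw [h1, Int.add_mul_emod_self_left, Int.emod_eq_of_lt hpos (by omega)]
    rw [h2, if_neg (by omega), if_pos ⟨t, by linear_combination hq⟩]
  · have h1 : mulExp g h = (rotExp (g * h) + 4 * N) + 8 * N * t := by linear_combination hq
    have h2 : mulExp g h % (8 * N) = rotExp (g * h) + 4 * N := by
      rw [h1, Int.add_mul_emod_self_left, Int.emod_eq_of_lt (by omega) (by omega)]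
    rw [h2, if_pos (by omega), if_neg]
    rintro ⟨u, hu⟩
    rw [hu] at hq
    have h4 : (4 * N : ℤ) ≠ 0 := by positivity
    have : 2 * u = 2 * t + 1 := mul_left_cancel₀ h4 (by linear_combination hq)
    omega

/-! ### The central extension -/

theorem proj_surjective : Function.Surjective (proj N) := by
  rintro (i | i)
  · obtain ⟨j, rfl⟩ := ZMod.intCast_surjective i
    exact ⟨.r j, congrArg DihedralGroup.r (map_intCast _ j)⟩
  · obtain ⟨j, rfl⟩ := ZMod.intCast_surjective i
    exact ⟨.sr j, congrArg DihedralGroup.sr (map_intCast _ j)⟩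

theorem mem_ker_proj {x : DihedralGroup (8 * N)} :
    x ∈ (proj N).ker ↔ ∃ t : ℤ, x = .r ((4 * N * t : ℤ) : ZMod (8 * N)) := by
  rw [MonoidHom.mem_ker, DihedralGroup.one_def]
  constructor
  · rcases x with i | i
    · intro h
      obtain ⟨j, rfl⟩ := ZMod.intCast_surjective i
      have h' : ZMod.castHom _ (ZMod (4 * N)) (j : ZMod (8 * N)) = 0 := DihedralGroup.r.inj h
      rw [map_intCast, ZMod.intCast_zmod_eq_zero_iff_dvd] at h'
      obtain ⟨t, rfl⟩ := h'
      exact ⟨t, by push_cast; rfl⟩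
    · intro h
      cases h
  · rintro ⟨t, rfl⟩
    refine congrArg DihedralGroup.r ?_
    rw [map_intCast, ZMod.intCast_zmod_eq_zero_iff_dvd]
    exact ⟨t, by push_cast; rfl⟩

theorem central_eq : (DihedralGroup.r 1 : DihedralGroup (8 * N)) ^ (4 * N) =
    .r ((4 * N : ℤ) : ZMod (8 * N)) := by
  rw [DihedralGroup.r_one_pow]
  push_cast
  rfl

theorem ker_proj_eq_zpowers :
    (proj N).ker = Subgroup.zpowers (DihedralGroup.r 1 ^ (4 * N)) := by
  ext x
  rw [mem_ker_proj, Subgroup.mem_zpowers_iff, central_eq]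
  refine exists_congr fun t => ?_
  rw [DihedralGroup.r_zpow, eq_comm]
  push_cast
  rfl

theorem eq_one_or_eq_of_mem_ker {x : DihedralGroup (8 * N)} (hx : x ∈ (proj N).ker) :
    x = 1 ∨ x = .r ((4 * N : ℤ) : ZMod (8 * N)) := by
  obtain ⟨t, rfl⟩ := mem_ker_proj.1 hx
  obtain ⟨u, rfl | rfl⟩ := Int.even_or_odd' t
  · left
    rw [DihedralGroup.one_def]
    congr 1
    rw [ZMod.intCast_zmod_eq_zero_iff_dvd]
    exact ⟨u, by push_cast; ring⟩
  · right
    congr 1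
    rw [ZMod.intCast_eq_intCast_iff_dvd_sub]
    exact ⟨-u, by push_cast; ring⟩

theorem central_mul_self : (DihedralGroup.r ((4 * N : ℤ) : ZMod (8 * N))) *
    .r ((4 * N : ℤ) : ZMod (8 * N)) = 1 := by
  rw [DihedralGroup.r_mul_r, DihedralGroup.one_def, ← Int.cast_add]
  congr 1
  rw [ZMod.intCast_zmod_eq_zero_iff_dvd]
  exact ⟨1, by push_cast; ring⟩

theorem central_ne_one : (DihedralGroup.r ((4 * N : ℤ) : ZMod (8 * N))) ≠ 1 := by
  have hN := NeZero.pos N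
  rw [DihedralGroup.one_def]
  intro h
  have h' := DihedralGroup.r.inj h
  rw [ZMod.intCast_zmod_eq_zero_iff_dvd] at h'
  have := Int.le_of_dvd (by positivity) h'
  push_cast at this
  omega

theorem ker_proj_le_center : (proj N).ker ≤ Subgroup.center (DihedralGroup (8 * N)) := by
  intro x hx
  rw [Subgroup.mem_center_iff]
  intro y
  obtain rfl | rfl := eq_one_or_eq_of_mem_ker hx
  · simp
  · rcases y with j | j
    · rw [DihedralGroup.r_mul_r, DihedralGroup.r_mul_r, add_comm]
    · rw [DihedralGroup.r_mul_sr, DihedralGroup.sr_mul_r]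
      -- Commutation with a reflection holds because `4N` is its own negative modulo `8N`.
      have h := DihedralGroup.r.inj ((DihedralGroup.r_mul_r _ _).symm.trans
        ((central_mul_self (N := N)).trans DihedralGroup.one_def))
      rw [eq_neg_of_add_eq_zero_left h, sub_neg_eq_add, ← sub_eq_add_neg,
        sub_eq_add_neg, ← eq_neg_of_add_eq_zero_left h]

theorem proj_lift (g : D N) : proj N (lift N g) = g := by
  have h1 : proj N (.r 1) = .r 1 := congrArg DihedralGroup.r (map_one _)
  have h2 : proj N (.sr 0) = .sr 0 := congrArg DihedralGroup.sr (map_zero _)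
  rw [lift, map_mul, map_pow, map_pow, h1, h2]
  rcases g with i | i
  · simp [rotExp, reflExp]
  · simp [rotExp, reflExp]

/-- The non-trivial character of the kernel of `D_{8N} → D_{4N}`. -/
def kerChar (N : ℕ) [NeZero N] : (proj N).ker →* Circle where
  toFun a := if (a : DihedralGroup (8 * N)) = 1 then 1 else -1
  map_one' := if_pos rfl
  map_mul' := by
    rintro ⟨a, ha⟩ ⟨b, hb⟩
    simp only [MulMemClass.mk_mul_mk]
    obtain rfl | rfl := eq_one_or_eq_of_mem_ker ha <;>
    obtain rfl | rfl := eq_one_or_eq_of_mem_ker hb <;>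
    simp only [central_mul_self, central_ne_one, mul_one, one_mul, if_true, if_false]
    ext
    simp

theorem alpha'_eq_kerChar (g h : D N) (a : (proj N).ker)
    (ha : lift N g * lift N h = a * lift N (g * h)) : alpha' N g h = kerChar N a := by
  have h1 : (a : DihedralGroup (8 * N)) =
      .r ((mulExp g h - rotExp (g * h) : ℤ) : ZMod (8 * N)) :=
    mul_right_cancel (ha.symm.trans (lift_mul_lift g h))
  have h2 : (a : DihedralGroup (8 * N)) = 1 ↔
      ((8 * N : ℕ) : ℤ) ∣ mulExp g h - rotExp (g * h) := by
    rw [h1, DihedralGroup.one_def, DihedralGroup.r.injEq, ZMod.intCast_zmod_eq_zero_iff_dvd]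
  rw [alpha'_eq]
  simp only [kerChar, MonoidHom.coe_mk, OneHom.coe_mk, h2]

/-- The cocycle identity is associativity of the product of three lifts, with the kernel elements
collected by centrality and then mapped to the circle by `kerChar`. -/
theorem isU1Cocycle_alpha' : IsU1Cocycle (alpha' N) := by
  have key : ∀ g h : D N, ∃ a : (proj N).ker, lift N g * lift N h = a * lift N (g * h) := by
    intro g h
    refine ⟨⟨lift N g * lift N h * (lift N (g * h))⁻¹, ?_⟩, by simp⟩
    rw [MonoidHom.mem_ker]
    simp [proj_lift]
  intro g h k
  obtain ⟨a, ha⟩ := key g h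
  obtain ⟨b, hb⟩ := key (g * h) k
  obtain ⟨c, hc⟩ := key g (h * k)
  obtain ⟨d, hd⟩ := key h k
  rw [alpha'_eq_kerChar g h a ha, alpha'_eq_kerChar _ k b hb, alpha'_eq_kerChar g _ c hc,
    alpha'_eq_kerChar h k d hd, ← map_mul, ← map_mul]
  congr 1
  apply Subtype.ext
  have hcen := Subgroup.mem_center_iff.1 (ker_proj_le_center d.2)
  apply mul_right_cancel (b := lift N (g * h * k))
  rw [Subgroup.coe_mul, Subgroup.coe_mul, mul_assoc, ← hb, ← mul_assoc, ← ha, mul_assoc, hd,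
    ← mul_assoc, hcen, mul_assoc, hc, ← mul_assoc, hcen, mul_assoc g h k]

theorem isU1Cocycle_alpha : IsU1Cocycle (alpha N) :=
  isU1Cocycle_alpha'.mul (isU1Cocycle_coboundary _)

/-! ### The boundary subgroups -/

theorem mem_zpowers_iff_of_mul_self {G : Type*} [Group G] {g x : G} (hg : g * g = 1) :
    x ∈ Subgroup.zpowers g ↔ x = 1 ∨ x = g := by
  constructor
  · have h2 : g ^ (2 : ℤ) = 1 := by rw [zpow_two, hg]
    rintro ⟨t, rfl⟩
    obtain ⟨u, rfl | rfl⟩ := Int.even_or_odd' t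
    · exact .inl (by simp only [zpow_mul, h2, one_zpow])
    · exact .inr (by simp only [zpow_add, zpow_mul, h2, one_zpow, one_mul, zpow_one])
  · rintro (rfl | rfl)
    · exact one_mem _
    · exact Subgroup.mem_zpowers _

theorem mem_bdry_zero {g : D N} : g ∈ bdry N 0 ↔ g = 1 ∨ g = r N * s N :=
  mem_zpowers_iff_of_mul_self (by rw [rs_eq, DihedralGroup.sr_mul_self])

theorem mem_bdry_one {g : D N} : g ∈ bdry N 1 ↔ g = 1 ∨ g = s N :=
  mem_zpowers_iff_of_mul_self (DihedralGroup.sr_mul_self 0)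

theorem mem_bdry_two {g : D N} : g ∈ bdry N 2 ↔ ∃ i, g = .r i := by
  change g ∈ Subgroup.zpowers (r N) ↔ _
  constructor
  · rintro ⟨t, rfl⟩
    exact ⟨t, DihedralGroup.r_one_zpow t⟩
  · rintro ⟨i, rfl⟩
    obtain ⟨j, rfl⟩ := ZMod.intCast_surjective i
    exact ⟨j, DihedralGroup.r_one_zpow j⟩

theorem rs_ne_s : r N * s N ≠ s N := fun h => by
  have := congrArg rotExp h
  simp at this

theorem rs_ne_one : r N * s N ≠ 1 := fun h => by
  have := congrArg reflExp h
  simp at this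

theorem reflExp_of_mem_bdry_two {g : D N} (hg : g ∈ bdry N 2) : reflExp g = 0 := by
  obtain ⟨i, rfl⟩ := mem_bdry_two.1 hg
  rfl

theorem eq_one_of_mem_bdry_of_mem_bdry {i j : Fin 3} (hij : i < j) {g : D N} (hi : g ∈ bdry N i)
    (hj : g ∈ bdry N j) : g = 1 := by
  fin_cases i <;> fin_cases j <;> try exact absurd hij (by decide)
  · obtain h | h := mem_bdry_zero.1 hi
    · exact h
    · obtain h' | h' := mem_bdry_one.1 hj
      · exact h'
      · exact absurd (h.symm.trans h') rs_ne_s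
  · obtain h | h := mem_bdry_zero.1 hi
    · exact h
    · have := reflExp_of_mem_bdry_two hj
      rw [h] at this
      simp at this
  · obtain h | h := mem_bdry_one.1 hi
    · exact h
    · have := reflExp_of_mem_bdry_two hj
      rw [h] at this
      simp at this

theorem bdry_inf_eq_bot (i j : Fin 3) (hij : i ≠ j) : bdry N i ⊓ bdry N j = ⊥ := by
  rw [eq_bot_iff]
  rintro g ⟨hi, hj⟩
  rw [Subgroup.mem_bot]
  rcases lt_or_gt_of_ne hij with h | h
  · exact eq_one_of_mem_bdry_of_mem_bdry h hi hj
  · exact eq_one_of_mem_bdry_of_mem_bdry h hj hi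

theorem rs_mul_s : r N * s N * s N = r N := by
  rw [mul_assoc, s, DihedralGroup.sr_mul_self, mul_one]

/-- A product is a rotation only if both factors are reflections or neither is. -/
theorem eq_labels {k₁ k₂ : D N} (h₁ : k₁ ∈ bdry N 0) (h₂ : k₂ ∈ bdry N 1)
    (h₃ : k₁ * k₂ ∈ bdry N 2) : (k₁ = 1 ∧ k₂ = 1) ∨ (k₁ = r N * s N ∧ k₂ = s N) := by
  have h := reflExp_of_mem_bdry_two h₃
  obtain rfl | rfl := mem_bdry_zero.1 h₁ <;> obtain rfl | rfl := mem_bdry_one.1 h₂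
  · exact .inl ⟨rfl, rfl⟩
  · simp at h
  · simp at h
  · exact .inr ⟨rfl, rfl⟩

theorem nonempty_mulEquiv_of_orderOf {G : Type*} [Group G] {g : G} {k : ℕ} (h : orderOf g = k) :
    Nonempty (Subgroup.zpowers g ≃* Multiplicative (ZMod k)) := by
  refine ⟨mulEquivOfCyclicCardEq ?_⟩
  rw [Nat.card_zpowers, h]
  exact (Nat.card_zmod k).symm

/-! ### Trivializations on the boundaries -/

theorem alpha'_one_left (h : D N) : alpha' N 1 h = 1 := by
  have : mulExp 1 h = rotExp h := by simp [mulExp]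
  rw [alpha'_eq, this, one_mul, sub_self, if_pos (dvd_zero _)]

theorem alpha'_one_right (g : D N) : alpha' N g 1 = 1 := by
  have : mulExp g 1 = rotExp g := by simp [mulExp]
  rw [alpha'_eq, this, mul_one, sub_self, if_pos (dvd_zero _)]

theorem alpha'_mul_self (g : D N) (hg : reflExp g = 1) : alpha' N g g = 1 := by
  have h1 : mulExp g g = 0 := by simp [mulExp, hg]
  have h2 : g * g = 1 := by
    rcases g with i | i
    · simp [reflExp] at hg
    · exact DihedralGroup.sr_mul_self i
  rw [alpha'_eq, h1, h2, rotExp_one]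
  simp

@[simp] theorem kappa_one : kappa N 1 = 1 := by
  have := NeZero.pos N
  rw [kappa, if_neg, if_neg] <;> simp <;> omega

theorem kappa_of_reflExp {g : D N} (hg : reflExp g = 1) : kappa N g = 1 := by
  simp [kappa, hg]

theorem alpha_eq_one_of_involution {a g h : D N} (ha : reflExp a = 1) (hg : g = 1 ∨ g = a)
    (hh : h = 1 ∨ h = a) : alpha N g h = 1 := by
  have haa : a * a = 1 := by
    rcases a with i | i
    · simp [reflExp] at ha
    · exact DihedralGroup.sr_mul_self i
  obtain rfl | rfl := hg <;> obtain rfl | rfl := hh <;>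
    simp [alpha, coboundary, alpha'_one_left, alpha'_one_right, alpha'_mul_self, ha,
      kappa_of_reflExp, haa]

/-- The trivialization of `α'_N` on the rotations. -/
def theta (N : ℕ) (g : D N) : Circle := Circle.exp (Real.pi * rotExp g / (4 * N))

/-- At `r^{2N}` the factor `-i` of `kappa` cancels the value `i` of `theta`. -/
theorem beta_eq {g : D N} (hg : reflExp g = 0) : beta N g = kappa N g * theta N g := by
  have hN : (N : ℝ) ≠ 0 := Nat.cast_ne_zero.2 (NeZero.ne N)
  simp only [beta, kappa, theta, hg, true_and]
  rcases lt_trichotomy (rotExp g) (2 * N) with h | h | h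
  · rw [if_pos h, if_neg h.ne, if_neg (by omega), one_mul]
  · rw [if_neg (by omega), if_pos h, if_pos h, ← Circle.exp_add, h, eq_comm, ← Circle.exp_zero]
    congr 1
    push_cast
    field_simp
    ring
  · rw [if_neg (by omega), if_neg (by omega), if_neg (by omega), if_pos h]
    ext
    simp

/-- For a rotation `g` the exponents add with a carry `q ∈ {0, 1}` modulo `4N`, and both sides equal
`(-1)^q`. -/
theorem alpha'_eq_coboundary_theta {g h : D N} (hg : reflExp g = 0) :
    alpha' N g h = coboundary (theta N) g h := by
  have hN : (N : ℝ) ≠ 0 := Nat.cast_ne_zero.2 (NeZero.ne N)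
  have hN0 := NeZero.pos N
  have h0 : mulExp g h = rotExp g + rotExp h := by simp [mulExp, hg]
  obtain ⟨q, hq⟩ := dvd_mulExp_sub g h
  have hlt : (rotExp (g * h) : ℤ) < 4 * N := by exact_mod_cast rotExp_lt (g * h)
  have hlt1 : (rotExp g : ℤ) < 4 * N := by exact_mod_cast rotExp_lt g
  have hlt2 : (rotExp h : ℤ) < 4 * N := by exact_mod_cast rotExp_lt h
  rw [alpha'_eq, h0] at *
  push_cast at hq
  have hq0 : 0 ≤ q := by
    by_contra hneg
    have : (4 * N : ℤ) * q ≤ 4 * N * (-1) := by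
      apply mul_le_mul_of_nonneg_left <;> omega
    omega
  have hq1 : q ≤ 1 := by
    by_contra hneg
    have : (4 * N : ℤ) * 2 ≤ 4 * N * q := by
      apply mul_le_mul_of_nonneg_left <;> omega
    omega
  have hq' : (rotExp g + rotExp h - rotExp (g * h) : ℝ) = 4 * N * q := by exact_mod_cast hq
  have hco : coboundary (theta N) g h = Circle.exp (Real.pi * q) := by
    rw [coboundary, theta, theta, theta, ← Circle.exp_add, ← Circle.exp_sub]
    congr 1
    field_simp
    linear_combination hq'
  rw [hco]
  obtain rfl | rfl : q = 0 ∨ q = 1 := by omega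
  · rw [hq]
    simp
  · rw [hq, if_neg]
    · ext
      simp
    · intro hd
      have := Int.le_of_dvd (by omega) hd
      push_cast at this
      omega

theorem alpha_eq_coboundary_betas (i : Fin 3) (g : D N) (hg : g ∈ bdry N i) (h : D N)
    (hh : h ∈ bdry N i) : alpha N g h = coboundary (betas N i) g h := by
  fin_cases i
  · rw [alpha_eq_one_of_involution reflExp_rs (mem_bdry_zero.1 hg) (mem_bdry_zero.1 hh)]
    simp [betas, coboundary]
  · rw [alpha_eq_one_of_involution reflExp_s (mem_bdry_one.1 hg) (mem_bdry_one.1 hh)]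
    simp [betas, coboundary]
  · have e1 := reflExp_of_mem_bdry_two hg
    have e2 := reflExp_of_mem_bdry_two hh
    have e3 := reflExp_of_mem_bdry_two (mul_mem hg hh)
    change alpha N g h = coboundary (beta N) g h
    rw [alpha, alpha'_eq_coboundary_theta e1]
    simp only [coboundary, beta_eq e1, beta_eq e2, beta_eq e3]
    rw [div_mul_div_comm]
    congr 1
    · rw [mul_comm (theta N g * _), mul_mul_mul_comm]
    · rw [mul_comm]

theorem beta_one : beta N 1 = 1 := by
  have := NeZero.pos N
  rw [beta, rotExp_one, if_pos (by omega)]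
  simp

theorem betas_one (i : Fin 3) : betas N i 1 = 1 := by
  fin_cases i
  · rfl
  · rfl
  · exact beta_one

theorem betas_compatible (i j : Fin 3) (g : D N) (hg : g ∈ bdry N i ⊓ bdry N j) :
    betas N i g = betas N j g := by
  obtain rfl | hij := eq_or_ne i j
  · rfl
  · rw [bdry_inf_eq_bot i j hij, Subgroup.mem_bot] at hg
    rw [hg, betas_one, betas_one]

theorem alpha_rs_s : alpha N (r N * s N) (s N) = 1 := by
  have hN := NeZero.pos N
  have h1 : mulExp (r N * s N) (s N) = 1 := by simp [mulExp]
  have hk : kappa N (r N) = 1 := by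
    rw [kappa, if_neg, if_neg] <;> simp <;> omega
  rw [alpha, coboundary, rs_mul_s, kappa_of_reflExp reflExp_rs, kappa_of_reflExp reflExp_s, hk,
    alpha'_eq, h1, rs_mul_s, rotExp_r]
  simp

theorem sptPhase_one : QuantumDouble.sptPhase (alpha N) (betas N) 1 1 = 1 := by
  have h : alpha N 1 1 = 1 := alpha_eq_one_of_involution reflExp_s (.inl rfl) (.inl rfl)
  rw [QuantumDouble.sptPhase, h, one_mul, mul_one, betas_one, betas_one, betas_one]
  simp

theorem sptPhase_rs_s : QuantumDouble.sptPhase (alpha N) (betas N) (r N * s N) (s N) =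
    Circle.exp (Real.pi / (4 * N)) := by
  have hN := NeZero.pos N
  have hb : beta N (r N) = Circle.exp (Real.pi / (4 * N)) := by
    rw [beta, rotExp_r, if_pos (by omega)]
    simp
  rw [QuantumDouble.sptPhase, alpha_rs_s, rs_mul_s]
  change 1 * beta N (r N) / (1 * 1) = _
  rw [hb]
  simp

/-! ### Characters -/

theorem chiR_mul (g h : D N) : chiR (g * h) = chiR g * chiR h := by
  rcases g with i | i <;> rcases h with j | j <;> simp [chiR, reflExp]

/-- The parity of the rotation exponent is additive: the sign `1 - 2j` disappears modulo `2`, and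
the reduction modulus `4N` is even. -/
theorem chiS_mul (g h : D N) : chiS (g * h) = chiS g * chiS h := by
  obtain ⟨q, hq⟩ := dvd_mulExp_sub g h
  rw [chiS, chiS, chiS, ← pow_add, neg_one_pow_congr]
  have : (rotExp g : ℤ) + rotExp h - rotExp (g * h) = 2 * (reflExp g * rotExp h + 2 * N * q) := by
    rw [mulExp] at hq
    push_cast at hq
    linear_combination hq
  rw [Nat.even_iff, Nat.even_iff]
  omega

theorem chiRS_of_mem {g : D N} (hg : g ∈ bdry N 0) : chiRS g = 1 := by
  obtain rfl | rfl := mem_bdry_zero.1 hg <;> simp [chiRS, chiR, chiS]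

theorem chiS_of_mem {g : D N} (hg : g ∈ bdry N 1) : chiS g = 1 := by
  obtain rfl | rfl := mem_bdry_one.1 hg <;> simp [chiS]

theorem chiR_of_mem {g : D N} (hg : g ∈ bdry N 2) : chiR g = 1 := by
  simp [chiR, reflExp_of_mem_bdry_two hg]

/-! ### The second cohomology group -/

/-- The central rotation `r^{2N}`. -/
def halfTurn (N : ℕ) : D N := .r ((2 * N : ℕ) : ZMod (4 * N))

theorem halfTurn_mul_s : halfTurn N * s N = s N * halfTurn N := by
  rw [halfTurn, s, DihedralGroup.r_mul_sr, DihedralGroup.sr_mul_r, zero_sub, zero_add]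
  congr 1
  rw [neg_eq_iff_add_eq_zero, ← Nat.cast_add, ZMod.natCast_eq_zero_iff]
  exact ⟨1, by ring⟩

theorem rotExp_halfTurn : rotExp (halfTurn N) = 2 * N := by
  have := NeZero.pos N
  exact ZMod.val_cast_of_lt (by omega)

/-- The coboundary of `kappa` is symmetric on commuting elements, so the sign is that of `alpha'`:
the exponents are `2N` in one order and `-2N ≡ 6N` modulo `8N` in the other. -/
theorem alpha_halfTurn_s : alpha N (halfTurn N) (s N) = -alpha N (s N) (halfTurn N) := by
  have hN := NeZero.pos N
  have h0 : reflExp (halfTurn N) = 0 := rfl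
  have e1 : alpha' N (halfTurn N) (s N) = 1 := by
    rw [alpha', if_neg]
    rw [rotExp_halfTurn, h0, rotExp_s]
    simp only [Nat.cast_zero, mul_zero, add_zero]
    rw [Int.emod_eq_of_lt] <;> push_cast <;> omega
  have e2 : alpha' N (s N) (halfTurn N) = -1 := by
    rw [alpha', if_pos]
    rw [rotExp_halfTurn, reflExp_s, rotExp_s]
    have : ((0 : ℕ) : ℤ) + (1 - 2 * (1 : ℕ)) * (2 * N : ℕ) = 6 * N + 8 * N * (-1) := by
      push_cast
      ring
    rw [this, Int.add_mul_emod_self_left, Int.emod_eq_of_lt] <;> omega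
  rw [alpha, alpha, e1, e2, coboundary, coboundary, halfTurn_mul_s, mul_comm (kappa N (s N))]
  ext
  simp

theorem exists_coboundary {α : D N → D N → Circle} (hα : IsU1Cocycle α)
    (h : α (halfTurn N) (s N) = α (s N) (halfTurn N)) : ∃ κ, ∀ g h, α g h = coboundary κ g h := by
  -- The order parameter is generalized so that `4 * N = 2 * (2 * N)` can be substituted inside the
  -- type.
  have key : ∀ n k : ℕ, n = 2 * k → k ≠ 0 → ∀ α : DihedralGroup n → DihedralGroup n → Circle,
      IsU1Cocycle α → α (.r k) (.sr 0) = α (.sr 0) (.r k) →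
      ∃ κ, ∀ g h, α g h = coboundary κ g h := by
    rintro n k rfl hk α hα h
    exact DihedralGroup.exists_coboundary hk hα h
  exact key (4 * N) (2 * N) (by ring) (by have := NeZero.pos N; omega) α hα h

/-- A coboundary is symmetric on commuting elements, whereas `alpha N` changes sign on `r^{2N}` and
`s`. -/
theorem not_exists_coboundary_alpha : ¬ ∃ κ, ∀ g h, alpha N g h = coboundary κ g h := by
  rintro ⟨κ, hκ⟩
  have h := alpha_halfTurn_s (N := N)
  rw [hκ, hκ, coboundary, coboundary, halfTurn_mul_s, mul_comm (κ (s N))] at h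
  have h' := congrArg (fun z : Circle => (z : ℂ)) h
  simp only [Circle.coe_neg] at h'
  exact Circle.coe_ne_zero _ (self_eq_neg.1 h')

theorem exists_H2π_alpha_ne_zero :
    ∃ h : toCochain (alpha N) ∈ groupCohomology.cocycles₂ (u1Rep (D N)),
      groupCohomology.H2π (u1Rep (D N)) ⟨toCochain (alpha N), h⟩ ≠ 0 := by
  refine ⟨toCochain_mem_cocycles₂.2 isU1Cocycle_alpha, fun h => ?_⟩
  rw [groupCohomology.H2π_eq_zero_iff] at h
  exact not_exists_coboundary_alpha (toCochain_mem_coboundaries₂.1 h)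

/-- The commutator sign of a cocycle is `1` or `-1`. In the first case it is a coboundary; in the
second its product with `alpha N` has sign `1` and is one. -/
theorem eq_zero_or_add_eq_zero (h : toCochain (alpha N) ∈ groupCohomology.cocycles₂ (u1Rep (D N)))
    (x : H2U1 (D N)) :
    x = 0 ∨ x + groupCohomology.H2π (u1Rep (D N)) ⟨toCochain (alpha N), h⟩ = 0 := by
  induction x using groupCohomology.H2_induction_on with
  | h x =>
    obtain ⟨f, hf⟩ := x
    obtain ⟨α, rfl⟩ : ∃ α, toCochain α = f := ⟨fun g h => Additive.toMul (f (g, h)), rfl⟩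
    have hα := toCochain_mem_cocycles₂.1 hf
    have hsq := hα.div_sq_of_commute (DihedralGroup.sr_mul_self 0 : s N * s N = 1) halfTurn_mul_s
    have hsq' : ((α (halfTurn N) (s N) / α (s N) (halfTurn N) : Circle) : ℂ) ^ 2 = 1 := by
      exact_mod_cast congrArg (fun z : Circle => (z : ℂ)) hsq
    rcases mul_self_eq_one_iff.1 ((pow_two _).symm.trans hsq') with h1 | h1
    · left
      rw [groupCohomology.H2π_eq_zero_iff]
      refine toCochain_mem_coboundaries₂.2 (exists_coboundary hα ?_)
      exact div_eq_one.1 (Circle.ext h1)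
    · right
      rw [← map_add, groupCohomology.H2π_eq_zero_iff]
      refine (toCochain_mem_coboundaries₂ (α := fun g k => α g k * alpha N g k)).2
        (exists_coboundary (hα.mul isU1Cocycle_alpha) ?_)
      have h2 : α (halfTurn N) (s N) = -α (s N) (halfTurn N) := by
        ext
        rw [Circle.coe_div, div_eq_iff (Circle.coe_ne_zero _)] at h1
        rw [h1, Circle.coe_neg, neg_one_mul]
      rw [h2, alpha_halfTurn_s]
      ext
      simp

theorem nonempty_H2U1_addEquiv : Nonempty (H2U1 (D N) ≃+ ZMod 2) := by
  obtain ⟨h, hne⟩ := exists_H2π_alpha_ne_zero (N := N)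
  have hcard : Nat.card (H2U1 (D N)) = 2 := by
    rw [Nat.card_eq_two_iff]
    refine ⟨0, -groupCohomology.H2π (u1Rep (D N)) ⟨toCochain (alpha N), h⟩,
      (neg_ne_zero.2 hne).symm, ?_⟩
    rw [Set.eq_univ_iff_forall]
    intro x
    obtain hx | hx := eq_zero_or_add_eq_zero h x
    · exact .inl hx
    · exact .inr (eq_neg_of_add_eq_zero_left hx)
  have : Fact (Nat.Prime 2) := ⟨Nat.prime_two⟩
  have hc : IsAddCyclic (H2U1 (D N)) := isAddCyclic_of_prime_card hcard
  exact ⟨(zmodAddCyclicAddEquiv hc).symm.trans (by rw [hcard])⟩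

end Dihedral4N

end

/-! ### Assembly of the theorem -/

open QuantumDouble Dihedral4N in
theorem corollary1 (N : ℕ) [NeZero N] :
    -- the boundary subgroups
    Nonempty (bdry N 0 ≃* Multiplicative (ZMod 2)) ∧
    Nonempty (bdry N 1 ≃* Multiplicative (ZMod 2)) ∧
    Nonempty (bdry N 2 ≃* Multiplicative (ZMod (4 * N))) ∧
    -- `H²(D_{4N}, U(1)) ≅ ℤ/2`, and `α_N` is a cocycle representing the non-trivial class
    Nonempty (H2U1 (D N) ≃+ ZMod 2) ∧
    (∃ h : toCochain (alpha N) ∈ groupCohomology.cocycles₂ (u1Rep (D N)),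
      groupCohomology.H2π (u1Rep (D N)) ⟨toCochain (alpha N), h⟩ ≠ 0) ∧
    -- `α'_N`, which is cohomologous to `α_N`, comes from the central extension `D_{8N} → D_{4N}`
    (Function.Surjective (proj N) ∧ (proj N).ker ≤ Subgroup.center (DihedralGroup (8 * N)) ∧
      (proj N).ker = Subgroup.zpowers (DihedralGroup.r 1 ^ (4 * N)) ∧
      (∀ g, proj N (lift N g) = g) ∧
      ∃ lam : (proj N).ker →* Circle,
        (∀ a : (proj N).ker, (a : DihedralGroup (8 * N)) = DihedralGroup.r 1 ^ (4 * N) →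
          lam a = -1) ∧
        ∀ (g h : D N) (a : (proj N).ker), lift N g * lift N h = a * lift N (g * h) →
          alpha' N g h = lam a) ∧
    -- trivializations on the boundaries, compatible at the corners
    (∀ g ∈ bdry N 0, ∀ h ∈ bdry N 0, alpha N g h = 1) ∧
    (∀ g ∈ bdry N 1, ∀ h ∈ bdry N 1, alpha N g h = 1) ∧
    (∀ i, ∀ g ∈ bdry N i, ∀ h ∈ bdry N i, alpha N g h = coboundary (betas N i) g h) ∧
    (∀ i j, ∀ g ∈ bdry N i ⊓ bdry N j, betas N i g = betas N j g) ∧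
    alpha N (r N * s N) (s N) = 1 ∧
    r N * s N * s N = r N ∧
    -- the phases on the two labels
    sptPhase (alpha N) (betas N) 1 1 = 1 ∧
    sptPhase (alpha N) (betas N) (r N * s N) (s N) = Circle.exp (Real.pi / (4 * N)) ∧
    -- the lattice code and the transversal gate
    ∀ (m n : ℕ) (p : Plaquette m n),
      let ψ₀ : State (D N) m n := magneticState (bdry N) p 1 1
      let ψ₁ : State (D N) m n := magneticState (bdry N) p (r N * s N) (s N)
      let U : Op (D N) m n := sptGate m n (alpha N) (betas N)
      -- the code space is one qubit with orthogonal logical basis `ψ₀`, `ψ₁` of equal norms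
      codeSpace m n (bdry N) = Submodule.span ℂ {ψ₀, ψ₁} ∧
      star ψ₀ ⬝ᵥ ψ₁ = 0 ∧ star ψ₀ ⬝ᵥ ψ₀ = star ψ₁ ⬝ᵥ ψ₁ ∧ ψ₀ ≠ 0 ∧ ψ₁ ≠ 0 ∧
      -- the logical `Z` is the electric triangle, at any vertex
      (∀ v : Vertex m n,
        electricOp chiRS chiS chiR v *ᵥ ψ₀ = ψ₀ ∧ electricOp chiRS chiS chiR v *ᵥ ψ₁ = -ψ₁) ∧
      -- the gate is a unitary circuit of local gates of constant depth
      U ∈ Matrix.unitaryGroup (Config (D N) m n) ℂ ∧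
      IsLocalCircuit 5 U ∧
      -- it preserves the code space and acts on the logical qubit as `T^{1/N}`
      (∀ ψ ∈ codeSpace m n (bdry N), U *ᵥ ψ ∈ codeSpace m n (bdry N)) ∧
      ∀ w : Fin 2 → ℂ,
        U *ᵥ encode ψ₀ ψ₁ w = encode ψ₀ ψ₁ (phaseGate (Real.pi / (4 * N)) *ᵥ w) := by
  have hrs : r N * s N ∈ bdry N 0 := mem_bdry_zero.2 (.inr rfl)
  have hs : s N ∈ bdry N 1 := mem_bdry_one.2 (.inr rfl)
  have hr : r N * s N * s N ∈ bdry N 2 := mem_bdry_two.2 ⟨1, rs_mul_s⟩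
  have h11 : (1 : D N) * 1 ∈ bdry N 2 := mul_mem (one_mem _) (one_mem _)
  refine ⟨nonempty_mulEquiv_of_orderOf ?_, nonempty_mulEquiv_of_orderOf ?_,
    nonempty_mulEquiv_of_orderOf DihedralGroup.orderOf_r_one, nonempty_H2U1_addEquiv,
    exists_H2π_alpha_ne_zero,
    ⟨proj_surjective, ker_proj_le_center, ker_proj_eq_zpowers, proj_lift, kerChar N, ?_,
      alpha'_eq_kerChar⟩,
    fun g hg h hh => alpha_eq_one_of_involution reflExp_rs (mem_bdry_zero.1 hg)
      (mem_bdry_zero.1 hh),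
    fun g hg h hh => alpha_eq_one_of_involution reflExp_s (mem_bdry_one.1 hg) (mem_bdry_one.1 hh),
    alpha_eq_coboundary_betas, betas_compatible, alpha_rs_s, rs_mul_s, sptPhase_one,
    sptPhase_rs_s, ?_⟩
  · rw [rs_eq]
    exact DihedralGroup.orderOf_sr _
  · exact DihedralGroup.orderOf_sr _
  · intro a ha
    change (if (a : DihedralGroup (8 * N)) = 1 then (1 : Circle) else -1) = -1
    rw [ha, central_eq, if_neg central_ne_one]
  intro m n p ψ₀ ψ₁ U
  have : NeZero m := ⟨(Fin.pos p.1).ne'⟩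
  have : NeZero n := ⟨(Fin.pos p.2).ne'⟩
  have hcode : codeSpace m n (bdry N) = Submodule.span ℂ {ψ₀, ψ₁} :=
    codeSpace_eq_span_pair bdry_inf_eq_bot p hrs hs hr rs_ne_one
      fun _ h₁ _ h₂ h₃ => eq_labels h₁ h₂ h₃
  -- By the discrete Stokes theorem the diagonal gate is constant on each sector, so its eigenvalues
  -- on `ψ₀` and `ψ₁` are the two values of `sptPhase`.
  have hU₀ : U *ᵥ ψ₀ = ψ₀ := by
    refine (congrArg (· *ᵥ ψ₀) (sptGate_eq _ _)).trans ?_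
    refine (diagonal_mulVec_magneticState bdry_inf_eq_bot p (one_mem _) (one_mem _) h11
      (a := 1) fun c hc => ?_).trans (one_smul _ _)
    rw [sptFun_eq_sptPhase isU1Cocycle_alpha alpha_eq_coboundary_betas betas_one hc, sptPhase_one,
      Circle.coe_one]
  have hU₁ : U *ᵥ ψ₁ = Complex.exp ((Real.pi / (4 * N) : ℝ) * Complex.I) • ψ₁ := by
    refine (congrArg (· *ᵥ ψ₁) (sptGate_eq _ _)).trans ?_
    refine diagonal_mulVec_magneticState bdry_inf_eq_bot p hrs hs hr fun c hc => ?_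
    rw [sptFun_eq_sptPhase isU1Cocycle_alpha alpha_eq_coboundary_betas betas_one hc, sptPhase_rs_s,
      Circle.coe_exp]
  refine ⟨hcode, ?_, ?_, ?_, ?_, fun v => ⟨?_, ?_⟩, ?_, isLocalCircuit_sptGate _ _, ?_, ?_⟩
  · exact star_magneticState_dotProduct bdry_inf_eq_bot p (one_mem _) (one_mem _) h11 hrs hs hr
      rs_ne_one.symm
  · exact (star_magneticState_dotProduct_self bdry_inf_eq_bot p (one_mem _) (one_mem _) h11).trans
      (star_magneticState_dotProduct_self bdry_inf_eq_bot p hrs hs hr).symm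
  · exact magneticState_ne_zero bdry_inf_eq_bot p (one_mem _) (one_mem _) h11
  · exact magneticState_ne_zero bdry_inf_eq_bot p hrs hs hr
  · refine (electricOp_mulVec_magneticState bdry_inf_eq_bot p (one_mem _) (one_mem _) h11 chiS_mul
      chiR_mul (fun _ => rfl) (fun _ => chiRS_of_mem) (fun _ => chiS_of_mem) (fun _ => chiR_of_mem)
      v).trans ?_
    simp [chiS, ψ₀]
  · refine (electricOp_mulVec_magneticState bdry_inf_eq_bot p hrs hs hr chiS_mul
      chiR_mul (fun _ => rfl) (fun _ => chiRS_of_mem) (fun _ => chiS_of_mem) (fun _ => chiR_of_mem)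
      v).trans ?_
    simp [chiS, ψ₁]
  · simp only [U, sptGate_eq]
    exact phaseOp_mem_unitaryGroup _
  · intro ψ hψ
    rw [hcode, Submodule.mem_span_pair] at hψ ⊢
    obtain ⟨a, b, rfl⟩ := hψ
    refine ⟨a, b * Complex.exp ((Real.pi / (4 * N) : ℝ) * Complex.I), ?_⟩
    rw [Matrix.mulVec_add, Matrix.mulVec_smul, Matrix.mulVec_smul, hU₀, hU₁, smul_smul]
  · intro w
    rw [encode, encode, Matrix.mulVec_add, Matrix.mulVec_smul, Matrix.mulVec_smul, hU₀, hU₁,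
      smul_smul, phaseGate, Matrix.mulVec_diagonal, Matrix.mulVec_diagonal]
    simp [mul_comm]
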